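/- **Counting Lemma.** Throughout, $\log$ is the natural logarithm, $c=\frac{1}{100\log 2}$, $A=10^{-4}c$, and $x=a\pm b$ means $a-b\le x\le a+b$. An integer $m$ is a *rounding* of a real number $x$ if $|m-x|<1$ (so $m=x$ if $x$ is an integer, and $m\in\{\lfloor x\rfloor,\lceil x\rceil\}$ otherwise). Given $\alpha>0$, a positive integer $t$ and a rounding $T$ of $\left(\frac12+\alpha\right)\binom t2$, a graph on $t$ vertices is an *$\alpha$-quasiclique* if it has exactly $T$ edges and each of its vertices has degree $\left(\frac12+\alpha\pm\frac{3\alpha}{4}\right)t$. For a graph $G$, let $\mathcal Q_G$ be the collection of all $t$-element subsets of $V(G)$ that induce an $\alpha$-quasiclique and, for $U\subseteq V(G)$, let $\mathcal Q_G(U)$ be the collection of the members of $\mathcal Q_G$ that contain $U$. A graph $G$ on $n$ vertices is *$(\alpha,t)$-good* (with respect to $T$) if $$|\mathcal Q_G(e)|=(1\pm n^{-A\alpha^2})\binom{n-2}{t-2}\binom{\binom t2-1}{T-1}2^{1-\binom t2}\quad\text{for every edge } e \text{ of } G,$$ $$|\mathcal Q_G(f)|=(1\pm n^{-A\alpha^2})\binom{n-2}{t-2}\binom{\binom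 t2-1}{T}2^{1-\binom t2}\quad\text{for every non-edge } f \text{ of } G,$$ $$|\mathcal Q_G|=(1\pm n^{-A\alpha^2})\binom nt\binom{\binom t2}{T}2^{-\binom t2}.$$ For every $\epsilon>0$ there exists $n_1=n_1(\epsilon)$ such that the following holds for all positive integers $n,t$, all nonnegative integers $T$ and all real $\alpha>0$. If $$n\ge n_1,\qquad \left(\frac1{\log n}\right)^{1/2-\epsilon}\le\alpha\le\frac12,$$ $t$ is a rounding of $c\alpha^{-2}\log n$ and $T$ is a rounding of $\left(\frac12+\alpha\right)\binom t2$, then the binomial random graph $G(n,1/2)$ is $(\alpha,t)$-good with respect to $T$ with probability at least $1-2\exp(-n^{1/5})$. -/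

import Mathlib

namespace QuasicliqueCounting

/-- The absolute constant `c = 1 / (100 log 2)` (natural logarithm). -/
noncomputable def c : ℝ := 1 / (100 * Real.log 2)

/-- The absolute constant `A = 10⁻⁴ c`. -/
noncomputable def A : ℝ := (10 : ℝ) ^ (-4 : ℤ) * c

/-- `m` is the real number `x` rounded to an integer, up or down: `m = x` if `x` is an integer, and
`m` is the floor or the ceiling of `x` otherwise. -/
def IsRounding (x : ℝ) (m : ℕ) : Prop := |(m : ℝ) - x| < 1

/-- `x = a ± b`, that is, `a - b ≤ x ≤ a + b`. -/
def PlusMinus (x a b : ℝ) : Prop := a - b ≤ x ∧ x ≤ a + b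

/-- A graph `H` on `t` vertices is an `α`-quasiclique with `T` edges if it has exactly `T` edges and
every vertex has degree `(1/2 + α ± 3α/4) t`. It is used for `T = (1/2 + α) (t choose 2)`,
rounded if this is not an integer. -/
def IsQuasiclique {W : Type*} (α : ℝ) (T : ℕ) (H : SimpleGraph W) : Prop :=
  H.edgeSet.ncard = T ∧
    ∀ v : W, PlusMinus ((H.neighborSet v).ncard : ℝ)
      ((1 / 2 + α) * (Nat.card W : ℝ)) (3 * α / 4 * (Nat.card W : ℝ))

open Classical in
/-- The collection of all `t`-element vertex subsets of `G` that induce an `α`-quasiclique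
(with `T` edges). -/
noncomputable def quasicliques {V : Type*} [Fintype V] (G : SimpleGraph V) (α : ℝ) (t T : ℕ) :
    Finset (Finset V) :=
  Finset.univ.filter fun S : Finset V =>
    S.card = t ∧ IsQuasiclique α T (G.induce (S : Set V))

open Classical in
/-- The members of `quasicliques G α t T` that contain the vertex set `U`. -/
noncomputable def quasicliquesThrough {V : Type*} [Fintype V] (G : SimpleGraph V) (α : ℝ)
    (t T : ℕ) (U : Finset V) : Finset (Finset V) :=
  (quasicliques G α t T).filter fun S => U ⊆ S

open Classical in
/-- `G`, a graph on `n` vertices, is `(α, t)`-good, where `T` is the number of edges of the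
quasicliques: the number of quasicliques through every edge, through every non-edge, and in total
is within a factor `1 ± n ^ (-A α²)` of its expected order. -/
def IsGood {V : Type*} [Fintype V] (α : ℝ) (t T : ℕ) (G : SimpleGraph V) : Prop :=
  let n : ℕ := Fintype.card V
  let N : ℕ := t.choose 2
  let δ : ℝ := (n : ℝ) ^ (-(A * α ^ 2))
  let M₁ : ℝ := ((n - 2).choose (t - 2) : ℝ) * ((N - 1).choose (T - 1) : ℝ) * 2 ^ (1 - (N : ℤ))
  let M₂ : ℝ := ((n - 2).choose (t - 2) : ℝ) * ((N - 1).choose T : ℝ) * 2 ^ (1 - (N : ℤ))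
  let M₀ : ℝ := (n.choose t : ℝ) * (N.choose T : ℝ) * 2 ^ (-(N : ℤ))
  (∀ u v : V, G.Adj u v →
    PlusMinus ((quasicliquesThrough G α t T {u, v}).card : ℝ) M₁ (δ * M₁)) ∧
  (∀ u v : V, u ≠ v → ¬ G.Adj u v →
    PlusMinus ((quasicliquesThrough G α t T {u, v}).card : ℝ) M₂ (δ * M₂)) ∧
  PlusMinus ((quasicliques G α t T).card : ℝ) M₀ (δ * M₀)

/-- The edge probability `1/2`. -/
noncomputable def half : unitInterval := ⟨1 / 2, by norm_num, by norm_num⟩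

end QuasicliqueCounting

/-!
That a `t`-set `S` induces a quasiclique is an event about its `N = t.choose 2` pairs, whose
probability is smaller than any fixed power of `1 / n`; so bounded differences are of no use.
The proof encodes the random graph by uniform random bits, one for each pair, and rests on a bound
for conditional probabilities (`expect_qcInd_cond_le`): whatever the graph on a vertex set `U` is,
the conditional probability that `S` is a quasiclique is at most `x ^ j` times the unconditional
bound `P = exactProb ..`, where `j` is the number of vertices that `S` and `U` share (outside the
fixed pair, if there is one) and `x = n ^ 0.3`.

* If `j` is less than `(log n) / 10`, at most `3 j ^ 2` bits have been revealed, so the probability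
  has grown by a factor of at most `2 ^ (3 j ^ 2)`.
* If `j` is larger, the degree condition enters: the shared vertices have degree at most
  `(1 / 2 + 7 α / 4) t`, so the vertices of `S` outside `U` have a large total degree, and this
  total is a weighted sum of unrevealed bits. The Chernoff bound (`expect_isQC_cond_le`) gives
  `exp (-α ^ 2 t ^ 2 + O(α ^ 2 t j))`, while `P` is at least `exp (-α ^ 2 t ^ 2 - O((α ^ 2 t) ^ 2))`
  up to powers of `t` by `exp_le_succ_mul_choose_div`. Since `α ^ 2 t` is about `c log n` with `c`
  small, and `j` is at least a constant times `log n`, the factor `x ^ j` covers the difference.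

The upper tail follows from the moment of order `k = n ^ (1 / 4)`
(`expect_sum_powersetCard_pow_le`): the sets in a `k`-tuple are revealed one at a time, and since
`x t (k t) / n` is small, each multiplies the expectation by at most a little more than the mean.

The lower tail (`expect_lower_tail_le`) needs only second moments. By an averaging device of
Hoeffding, the count is an average, over the permutations of the vertices, of counts inside
`m = n ^ (1 / 4)` disjoint blocks of `n ^ (3 / 4)` vertices. The blocks are independent, and in each
of them the second moment is at most twice the square of the mean, so the Laplace transform of each
of these nonnegative variables is as small as it should be.

The degree condition hardly changes the mean (`le_expect_isQC`), by a tail bound for the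
hypergeometric distribution (`card_hypergeometric_tail_le`). To count through a pair, its bit is
fixed to `true` or `false` beforehand. The lower bound on `α` enters as
`1 / log n ≤ α ^ 2`, which makes `t` at most `(log n) ^ 2`.
-/

namespace QuasicliqueCounting

open Finset MeasureTheory
open scoped BigOperators

/-! ### Uniform random bits -/

section Bits

theorem dependsOn_finset_prod {ι κ : Type*} {s : Finset κ} {f : κ → (ι → Bool) → ℝ}
    {F : κ → Set ι} {G : Set ι} (hf : ∀ b ∈ s, DependsOn (f b) (F b)) (hG : ∀ b ∈ s, F b ⊆ G) :
    DependsOn (fun ω => ∏ b ∈ s, f b ω) G := fun _ _ h =>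
  prod_congr rfl fun b hb => hf b hb fun i hi => h i (hG b hb hi)

variable {ι : Type*} [DecidableEq ι]

theorem dependsOn_piecewise {F : Finset ι} {f : (ι → Bool) → ℝ} (hf : DependsOn f (F : Set ι))
    (ω ω' : ι → Bool) : f (F.piecewise ω ω') = f ω :=
  hf fun i hi => by simp [mem_coe.1 hi]

theorem dependsOn_piecewise_of_disjoint {F : Finset ι} {s : Set ι} {f : (ι → Bool) → ℝ}
    (hf : DependsOn f s) (hs : Disjoint (F : Set ι) s) (ω ω' : ι → Bool) :
    f (F.piecewise ω ω') = f ω' :=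
  hf fun i hi => by
    have : i ∉ F := fun h => Set.disjoint_left.1 hs (mem_coe.2 h) hi
    simp [this]

variable [Fintype ι]

theorem expect_piecewise (F : Finset ι) (h : (ι → Bool) → ℝ) :
    𝔼 ω, h ω = 𝔼 ω, 𝔼 ω', h (F.piecewise ω ω') := by
  have h1 : 𝔼 ω, h ω = 𝔼 p : (ι → Bool) × (ι → Bool), h p.1 := by
    rw [← univ_product_univ, expect_product]
    simp
  have h2 : 𝔼 p : (ι → Bool) × (ι → Bool), h (F.piecewise p.1 p.2) =
      𝔼 p : (ι → Bool) × (ι → Bool), h p.1 := by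
    have hinv : Function.Involutive
        (fun p : (ι → Bool) × (ι → Bool) => (F.piecewise p.1 p.2, F.piecewise p.2 p.1)) := by
      intro p
      ext i <;> by_cases hi : i ∈ F <;> simp [hi]
    exact Fintype.expect_bijective _ hinv.bijective _ _ (fun p => rfl)
  rw [h1, ← h2, ← univ_product_univ, expect_product]

/-- If `f` is determined by the bits in `F`, and the conditional expectation of `g` given these
bits never exceeds `R`, then `𝔼 f g ≤ R 𝔼 f`. -/
theorem expect_mul_le_of_cond_le {F : Finset ι} {f g : (ι → Bool) → ℝ} {R : ℝ}
    (hf : DependsOn f (F : Set ι)) (hf0 : ∀ ω, 0 ≤ f ω)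
    (hg : ∀ ω, 𝔼 ω', g (F.piecewise ω ω') ≤ R) :
    𝔼 ω, f ω * g ω ≤ (𝔼 ω, f ω) * R := by
  rw [expect_piecewise F, expect_mul]
  refine expect_le_expect fun ω _ => ?_
  simp_rw [dependsOn_piecewise hf, ← mul_expect]
  exact mul_le_mul_of_nonneg_left (hg ω) (hf0 ω)

theorem expect_mul_of_dependsOn {F : Finset ι} {s : Set ι} {f g : (ι → Bool) → ℝ}
    (hf : DependsOn f (F : Set ι)) (hg : DependsOn g s) (hs : Disjoint (F : Set ι) s) :
    𝔼 ω, f ω * g ω = (𝔼 ω, f ω) * 𝔼 ω, g ω := by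
  rw [expect_piecewise F, expect_mul]
  refine expect_congr rfl fun ω _ => ?_
  simp_rw [dependsOn_piecewise hf, dependsOn_piecewise_of_disjoint hg hs, ← mul_expect]

theorem expect_prod_of_dependsOn {κ : Type*} (s : Finset κ) {f : κ → (ι → Bool) → ℝ}
    {F : κ → Finset ι} (hf : ∀ b ∈ s, DependsOn (f b) (F b : Set ι))
    (hF : (s : Set κ).PairwiseDisjoint F) :
    𝔼 ω, ∏ b ∈ s, f b ω = ∏ b ∈ s, 𝔼 ω, f b ω := by
  classical
  induction s using Finset.induction_on with
  | empty => simp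
  | insert a s ha ih =>
    simp_rw [prod_insert ha]
    rw [expect_mul_of_dependsOn (F := F a) (s := ((s.biUnion F : Finset ι) : Set ι))
      (hf a (mem_insert_self _ _)), ih]
    · exact fun b hb => hf b (mem_insert_of_mem hb)
    · exact hF.subset (by simp)
    · refine dependsOn_finset_prod (F := fun b => (F b : Set ι))
        (fun b hb => hf b (mem_insert_of_mem hb)) fun b hb => ?_
      exact_mod_cast subset_biUnion_of_mem F hb
    · rw [disjoint_coe, disjoint_biUnion_right]
      intro b hb
      exact hF (by simp) (by simp [hb]) (by rintro rfl; exact ha hb)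

theorem expect_comp_flip (i : ι) (h : (ι → Bool) → ℝ) :
    𝔼 ω, h (Function.update ω i (!ω i)) = 𝔼 ω, h ω := by
  have hinv : Function.Involutive (fun ω : ι → Bool => Function.update ω i (!ω i)) := by
    intro ω
    simp
  exact Fintype.expect_bijective _ hinv.bijective _ _ (fun p => rfl)

theorem expect_comp_update_le (i : ι) (b : Bool) {h : (ι → Bool) → ℝ} (h0 : ∀ ω, 0 ≤ h ω) :
    𝔼 ω, h (Function.update ω i b) ≤ 2 * 𝔼 ω, h ω := by
  have h2 : 2 * 𝔼 ω, h ω = 𝔼 ω, (h ω + h (Function.update ω i (!ω i))) := by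
    rw [expect_add_distrib, expect_comp_flip, two_mul]
  rw [h2]
  refine expect_le_expect fun ω _ => ?_
  rcases eq_or_ne b (ω i) with rfl | hb
  · simpa using h0 _
  · have : b = !ω i := by cases b <;> cases hh : ω i <;> simp_all
    rw [this]
    simpa using h0 _

/-- Conditioning on the values of the bits in `F` raises the expectation of a nonnegative function
by a factor of at most `2 ^ #F`. -/
theorem expect_cond_le (F : Finset ι) (ω₀ : ι → Bool) {h : (ι → Bool) → ℝ} (h0 : ∀ ω, 0 ≤ h ω) :
    𝔼 ω, h (F.piecewise ω₀ ω) ≤ 2 ^ #F * 𝔼 ω, h ω := by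
  induction F using Finset.induction_on generalizing h with
  | empty => simp
  | insert i F hi ih =>
    simp_rw [piecewise_insert]
    refine (ih (h := fun ω => h (Function.update ω i (ω₀ i))) fun ω => h0 _).trans ?_
    rw [card_insert_of_notMem hi, pow_succ, mul_assoc]
    exact mul_le_mul_of_nonneg_left (expect_comp_update_le i _ h0) (by positivity)

theorem expect_bit (i : ι) (f : Bool → ℝ) :
    𝔼 ω : ι → Bool, f (ω i) = (f true + f false) / 2 := by
  have h1 := expect_comp_flip i fun ω => f (ω i)
  have h2 : 𝔼 ω : ι → Bool, (f (ω i) + f (!ω i)) = f true + f false := by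
    rw [← expect_const (s := (univ : Finset (ι → Bool))) univ_nonempty (f true + f false)]
    refine expect_congr rfl fun ω _ => ?_
    cases ω i <;> simp [add_comm]
  rw [expect_add_distrib] at h2
  simp only [Function.update_self] at h1
  linarith

theorem expect_prod_bit (K : Finset ι) (f : ι → Bool → ℝ) :
    𝔼 ω : ι → Bool, ∏ i ∈ K, f i (ω i) = ∏ i ∈ K, (f i true + f i false) / 2 := by
  rw [expect_prod_of_dependsOn K (F := fun i => {i})]
  · exact prod_congr rfl fun i _ => expect_bit i (f i)
  · intro i _ x y h
    simp [h i (by simp)]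
  · intro i _ j _ hij
    simpa [Function.onFun] using hij

/-- The trace of a configuration on `K`: the set of the indices in `K` whose bit is `true`. -/
def trace (K : Finset ι) (ω : ι → Bool) : Finset ι := {i ∈ K | ω i}

theorem expect_trace_eq {K H : Finset ι} (hH : H ⊆ K) :
    𝔼 ω : ι → Bool, (if trace K ω = H then (1 : ℝ) else 0) = 1 / 2 ^ #K := by
  have : ∀ ω : ι → Bool, (if trace K ω = H then (1 : ℝ) else 0) =
      ∏ i ∈ K, (fun i b => if (b = true ↔ i ∈ H) then (1 : ℝ) else 0) i (ω i) := by
    intro ω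
    rw [prod_ite_zero]
    simp only [prod_const_one]
    refine if_congr ?_ rfl rfl
    simp only [trace, Finset.ext_iff, mem_filter]
    constructor
    · intro h i hi
      rw [← h i]
      simp [hi]
    · intro h i
      constructor
      · rintro ⟨hi, hb⟩
        exact (h i hi).1 hb
      · intro hi
        exact ⟨hH hi, (h i (hH hi)).2 hi⟩
  rw [expect_congr rfl fun ω _ => this ω,
    expect_prod_bit K fun i b => if (b = true ↔ i ∈ H) then (1 : ℝ) else 0]
  have h2 : ∀ i ∈ K, ((if (true = true ↔ i ∈ H) then (1 : ℝ) else 0) +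
      (if (false = true ↔ i ∈ H) then (1 : ℝ) else 0)) / 2 = 1 / 2 := by
    intro i _
    by_cases hi : i ∈ H <;> simp [hi]
  rw [prod_congr rfl h2]
  simp

theorem expect_trace_mem {K : Finset ι} {𝓗 : Finset (Finset ι)} (h : 𝓗 ⊆ K.powerset) :
    𝔼 ω : ι → Bool, (if trace K ω ∈ 𝓗 then (1 : ℝ) else 0) = #𝓗 / 2 ^ #K := by
  have : ∀ ω : ι → Bool, (if trace K ω ∈ 𝓗 then (1 : ℝ) else 0) =
      ∑ H ∈ 𝓗, if trace K ω = H then (1 : ℝ) else 0 := by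
    intro ω
    simp
  simp_rw [this]
  rw [expect_sum_comm, sum_congr rfl fun H hH => expect_trace_eq (mem_powerset.1 (h hH))]
  simp [div_eq_mul_inv]

end Bits

/-! ### Binomial coefficients and the hypergeometric tail -/

/-- The binomial distribution with parameters `N` and `T / N` has its mode at `T`, so that it takes
the value `T` with probability at least `1 / (N + 1)`. Stated with the denominators cleared. -/
theorem pow_self_le_succ_mul_choose_mul {N T : ℕ} (hT : T ≤ N) :
    N ^ N ≤ (N + 1) * (N.choose T * T ^ T * (N - T) ^ (N - T)) := by
  set b : ℕ → ℕ := fun k => N.choose k * T ^ k * (N - T) ^ (N - k) with hb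
  have step : ∀ k, k < N → ∃ x : ℕ, (k + 1) * b (k + 1) = x * ((N - k) * T) ∧
      (k + 1) * b k = x * ((k + 1) * (N - T)) := by
    intro k hk
    refine ⟨N.choose k * T ^ k * (N - T) ^ (N - (k + 1)), ?_, ?_⟩
    · have := Nat.choose_succ_right_eq N k
      simp only [hb, pow_succ]
      calc (k + 1) * (N.choose (k + 1) * (T ^ k * T) * (N - T) ^ (N - (k + 1)))
          = (N.choose (k + 1) * (k + 1)) * ((T ^ k * T) * (N - T) ^ (N - (k + 1))) := by ring
        _ = _ := by rw [this]; ring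
    · have : N - k = N - (k + 1) + 1 := by omega
      simp only [hb]
      rw [this, pow_succ]
      ring
  -- The terms `b k` increase up to `k = T` and decrease from there on.
  have up : ∀ k, k < T → b k ≤ b (k + 1) := by
    intro k hk
    obtain ⟨x, h1, h2⟩ := step k (by omega)
    refine Nat.le_of_mul_le_mul_left (c := k + 1) ?_ (by omega)
    rw [h1, h2]
    refine Nat.mul_le_mul_left _ ?_
    rw [mul_comm]
    exact Nat.mul_le_mul (by omega) hk
  have down : ∀ k, T ≤ k → b (k + 1) ≤ b k := by
    intro k hk
    by_cases hkN : k < N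
    · obtain ⟨x, h1, h2⟩ := step k hkN
      refine Nat.le_of_mul_le_mul_left (c := k + 1) ?_ (by omega)
      rw [h1, h2]
      refine Nat.mul_le_mul_left _ ?_
      rw [mul_comm]
      exact Nat.mul_le_mul (by omega) (by omega)
    · simp [hb, Nat.choose_eq_zero_of_lt (show N < k + 1 by omega)]
  have hmax : ∀ k, b k ≤ b T := by
    intro k
    rcases le_total k T with h | h
    · induction hd : T - k generalizing k with
      | zero => rw [show k = T by omega]
      | succ d ih => exact (up k (by omega)).trans (ih (k + 1) (by omega) (by omega))
    · exact Nat.le_induction le_rfl (fun m hm ih => (down m hm).trans ih) k h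
  calc N ^ N = (T + (N - T)) ^ N := by rw [Nat.add_sub_cancel' hT]
    _ = ∑ k ∈ range (N + 1), b k := by
      rw [add_pow]
      exact sum_congr rfl fun k _ => by simp only [hb, Nat.cast_id]; ring
    _ ≤ ∑ k ∈ range (N + 1), b T := sum_le_sum fun k _ => hmax k
    _ = _ := by simp [hb]

theorem one_le_succ_mul_choose_mul {N T : ℕ} (hN : 0 < N) (hT : T ≤ N) :
    1 ≤ ((N : ℝ) + 1) * (N.choose T * (T / N : ℝ) ^ T * (1 - T / N : ℝ) ^ (N - T)) := by
  have h := pow_self_le_succ_mul_choose_mul hT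
  have h' : (N : ℝ) ^ N ≤ (N + 1) * (N.choose T * T ^ T * ((N - T : ℕ) : ℝ) ^ (N - T)) := by
    exact_mod_cast h
  have hN' : (0 : ℝ) < N := by exact_mod_cast hN
  rw [Nat.cast_sub hT] at h'
  have e1 : (1 - T / N : ℝ) = (N - T) / N := by field_simp
  have e2 : (N : ℝ) ^ N = N ^ T * N ^ (N - T) := by rw [← pow_add, Nat.add_sub_cancel' hT]
  rw [e1, div_pow, div_pow]
  calc (1 : ℝ) = N ^ N / N ^ N := by field_simp
    _ ≤ (N + 1) * (N.choose T * T ^ T * ((N : ℝ) - T) ^ (N - T)) / N ^ N := by gcongr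
    _ = _ := by rw [e2]; field_simp

/-- For `x > -1` this says `log (1 + x) ≤ x - x ^ 2 / 2 + x ^ 3 / 3`; the quotient of the two sides
has its maximum at `0`, as its derivative has the sign of `-x ^ 3`. -/
theorem one_add_le_exp_cubic (x : ℝ) :
    1 + x ≤ Real.exp (x - x ^ 2 / 2 + x ^ 3 / 3) := by
  set h : ℝ → ℝ := fun y => (1 + y) * Real.exp (-(y - y ^ 2 / 2 + y ^ 3 / 3)) with hh
  have hd : ∀ y, HasDerivAt h (Real.exp (-(y - y ^ 2 / 2 + y ^ 3 / 3)) * (-y ^ 3)) y := by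
    intro y
    have h1 : HasDerivAt (fun y : ℝ => -(y - y ^ 2 / 2 + y ^ 3 / 3)) (-(1 - y + y ^ 2)) y := by
      have := (((hasDerivAt_id y).sub ((hasDerivAt_pow 2 y).div_const 2)).add
        ((hasDerivAt_pow 3 y).div_const 3)).neg
      refine this.congr_deriv ?_
      simp
    refine (((hasDerivAt_id y).const_add 1).mul h1.exp).congr_deriv ?_
    simp
    ring
  have hc : Continuous h := continuous_iff_continuousAt.2 fun y => (hd y).continuousAt
  have key : h x ≤ h 0 := by
    rcases le_total x 0 with h0 | h0
    · refine monotoneOn_of_deriv_nonneg (convex_Iic 0) hc.continuousOn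
        (fun y _ => (hd y).differentiableAt.differentiableWithinAt) (fun y hy => ?_)
        (Set.mem_Iic.2 h0) (Set.mem_Iic.2 le_rfl) h0
      rw [interior_Iic] at hy
      rw [(hd y).deriv]
      have : 0 ≤ (-y) ^ 3 := pow_nonneg (by simpa using le_of_lt hy) 3
      have : 0 ≤ -y ^ 3 := by linarith [show (-y) ^ 3 = -y ^ 3 by ring]
      positivity
    · refine antitoneOn_of_deriv_nonpos (convex_Ici 0) hc.continuousOn
        (fun y _ => (hd y).differentiableAt.differentiableWithinAt) (fun y hy => ?_)
        (Set.mem_Ici.2 le_rfl) (Set.mem_Ici.2 h0) h0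
      rw [interior_Ici] at hy
      rw [(hd y).deriv]
      have : 0 ≤ y ^ 3 := pow_nonneg (le_of_lt hy) 3
      exact mul_nonpos_of_nonneg_of_nonpos (Real.exp_pos _).le (by linarith)
  have h00 : h 0 = 1 := by simp [hh]
  rw [h00] at key
  simp only [hh, Real.exp_neg] at key
  rwa [mul_inv_le_iff₀ (Real.exp_pos _), one_mul] at key

/-- A lower bound for the probability that a fair binomial variable takes the value `T`, where
`β = T / N - 1 / 2`: the divergence `log 2 - H (1 / 2 + β)` is at most `2 β ^ 2 + 16 β ^ 4 / 3`. -/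
theorem exp_le_succ_mul_choose_div {N T : ℕ} (hN : 0 < N) (hT : T ≤ N) :
    Real.exp (-(N * (2 * (T / N - 1 / 2 : ℝ) ^ 2 + 16 / 3 * (T / N - 1 / 2 : ℝ) ^ 4))) ≤
      ((N : ℝ) + 1) * (N.choose T / 2 ^ N) := by
  have hN' : (0 : ℝ) < N := by exact_mod_cast hN
  have hTN : (T : ℝ) ≤ N := by exact_mod_cast hT
  have hm := one_le_succ_mul_choose_mul hN hT
  set p : ℝ := T / N with hp
  have hp0 : 0 ≤ p := by positivity
  have hp1 : p ≤ 1 := (div_le_one hN').2 hTN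
  set x : ℝ := 2 * p - 1 with hx
  have hTx : (T : ℝ) = N * ((1 + x) / 2) := by rw [hx, hp]; field_simp; ring
  have hTx' : ((N - T : ℕ) : ℝ) = N * ((1 - x) / 2) := by
    rw [Nat.cast_sub hT]; linarith
  have b1 : (2 * p) ^ T ≤ Real.exp (T * (x - x ^ 2 / 2 + x ^ 3 / 3)) := by
    rw [Real.exp_nat_mul]
    refine pow_le_pow_left₀ (by positivity) ?_ _
    have := one_add_le_exp_cubic x
    rwa [show 2 * p = 1 + x by rw [hx]; ring]
  have b2 : (2 * (1 - p)) ^ (N - T) ≤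
      Real.exp ((N - T : ℕ) * (-x - (-x) ^ 2 / 2 + (-x) ^ 3 / 3)) := by
    rw [Real.exp_nat_mul]
    refine pow_le_pow_left₀ (by linarith) ?_ _
    have := one_add_le_exp_cubic (-x)
    rwa [show 2 * (1 - p) = 1 + -x by rw [hx]; ring]
  have b3 : (2 : ℝ) ^ N * (p ^ T * (1 - p) ^ (N - T)) ≤
      Real.exp (N * (2 * (p - 1 / 2) ^ 2 + 16 / 3 * (p - 1 / 2) ^ 4)) := by
    calc (2 : ℝ) ^ N * (p ^ T * (1 - p) ^ (N - T)) = (2 * p) ^ T * (2 * (1 - p)) ^ (N - T) := by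
          rw [mul_pow, mul_pow, show (2 : ℝ) ^ N = 2 ^ T * 2 ^ (N - T) by
            rw [← pow_add, Nat.add_sub_cancel' hT]]
          ring
      _ ≤ _ := mul_le_mul b1 b2 (pow_nonneg (by linarith) _) (Real.exp_pos _).le
      _ = _ := by
        rw [← Real.exp_add, hTx, hTx', show p - 1 / 2 = x / 2 by rw [hx]; ring]
        congr 1
        ring
  rw [Real.exp_neg, inv_le_iff_one_le_mul₀ (Real.exp_pos _)]
  calc (1 : ℝ) ≤ (N + 1) * (N.choose T * p ^ T * (1 - p) ^ (N - T)) := hm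
    _ = (N + 1) * (N.choose T / 2 ^ N) * (2 ^ N * (p ^ T * (1 - p) ^ (N - T))) := by
      field_simp
    _ ≤ _ := by gcongr

theorem exp_le_add_exp_sq (x : ℝ) : Real.exp x ≤ x + Real.exp (x ^ 2) := by
  have h1 := Real.add_one_le_exp (x ^ 2)
  rcases le_total x (-1) with h | h
  · have : Real.exp x ≤ 1 := Real.exp_le_one_iff.2 (by linarith)
    nlinarith
  rcases le_total x 1 with h' | h'
  · have := Real.abs_exp_sub_one_sub_id_le (x := x) (abs_le.2 ⟨h, h'⟩)
    linarith [le_abs_self (Real.exp x - 1 - x)]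
  · have : Real.exp x ≤ Real.exp (x ^ 2) := Real.exp_le_exp.2 (by nlinarith)
    linarith

theorem bernoulli_mgf_le {p : ℝ} (hp0 : 0 ≤ p) (hp1 : p ≤ 1) (l : ℝ) :
    p * Real.exp l + (1 - p) ≤ Real.exp (l * p + l ^ 2) := by
  have h1 := exp_le_add_exp_sq (l * (1 - p))
  have h2 := exp_le_add_exp_sq (-(l * p))
  have e1 : Real.exp ((l * (1 - p)) ^ 2) ≤ Real.exp (l ^ 2) := by
    rw [Real.exp_le_exp, mul_pow]
    have : (1 - p) ^ 2 ≤ 1 := by nlinarith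
    nlinarith [sq_nonneg l]
  have e2 : Real.exp ((-(l * p)) ^ 2) ≤ Real.exp (l ^ 2) := by
    rw [Real.exp_le_exp, neg_sq, mul_pow]
    have : p ^ 2 ≤ 1 := by nlinarith
    nlinarith [sq_nonneg l]
  have key : p * Real.exp (l * (1 - p)) + (1 - p) * Real.exp (-(l * p)) ≤ Real.exp (l ^ 2) := by
    have a1 := mul_le_mul_of_nonneg_left (h1.trans (add_le_add_right e1 _)) hp0
    have a2 := mul_le_mul_of_nonneg_left (h2.trans (add_le_add_right e2 _)) (sub_nonneg.2 hp1)
    nlinarith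
  calc p * Real.exp l + (1 - p)
      = Real.exp (l * p) * (p * Real.exp (l * (1 - p)) + (1 - p) * Real.exp (-(l * p))) := by
        rw [mul_add, mul_left_comm, mul_left_comm _ (1 - p), ← Real.exp_add, ← Real.exp_add]
        ring_nf
        simp
        ring
    _ ≤ Real.exp (l * p) * Real.exp (l ^ 2) := by gcongr
    _ = _ := by rw [← Real.exp_add]

section Hypergeometric

variable {ι : Type*} [DecidableEq ι]

/-- The moment generating function of the hypergeometric distribution is at most `#K + 1` times the
one of the corresponding binomial distribution. -/
theorem sum_powersetCard_exp_le {K L : Finset ι} {T : ℕ} (hL : L ⊆ K) (hK : 0 < #K)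
    (hT : T ≤ #K) (l : ℝ) :
    ∑ H ∈ powersetCard T K, Real.exp (l * (#(H ∩ L) - T / #K * #L)) ≤
      (#K + 1) * (#K).choose T * Real.exp (l ^ 2 * #L) := by
  have hK' : (0 : ℝ) < #K := by exact_mod_cast hK
  have hTN : (T : ℝ) ≤ #K := by exact_mod_cast hT
  have hm := one_le_succ_mul_choose_mul hK hT
  set p : ℝ := T / #K with hp
  have hp0 : 0 ≤ p := by positivity
  have hp1 : p ≤ 1 := (div_le_one hK').2 hTN
  have hw : p ^ T * (1 - p) ^ (#K - T) *
      ∑ H ∈ powersetCard T K, Real.exp (l * (#(H ∩ L) - p * #L)) ≤ Real.exp (l ^ 2 * #L) := by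
    calc p ^ T * (1 - p) ^ (#K - T) *
          ∑ H ∈ powersetCard T K, Real.exp (l * (#(H ∩ L) - p * #L))
        = Real.exp (-(l * p * #L)) * ∑ H ∈ powersetCard T K,
            (∏ i ∈ H, p * (if i ∈ L then Real.exp l else 1)) * ∏ i ∈ K \ H, (1 - p) := by
          rw [mul_sum, mul_sum]
          refine sum_congr rfl fun H hH => ?_
          obtain ⟨hHK, hHT⟩ := mem_powersetCard.1 hH
          rw [prod_mul_distrib, prod_const, prod_const, card_sdiff_of_subset hHK, hHT,
            prod_ite_mem, prod_const, ← Real.exp_nat_mul,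
            show l * (#(H ∩ L) - p * #L) = -(l * p * #L) + #(H ∩ L) * l by ring, Real.exp_add]
          ring
      _ ≤ Real.exp (-(l * p * #L)) * ∑ H ∈ K.powerset,
            (∏ i ∈ H, p * (if i ∈ L then Real.exp l else 1)) * ∏ i ∈ K \ H, (1 - p) := by
          refine mul_le_mul_of_nonneg_left ?_ (Real.exp_pos _).le
          refine sum_le_sum_of_subset_of_nonneg (fun H hH => ?_) fun H _ _ => ?_
          · exact mem_powerset.2 (mem_powersetCard.1 hH).1
          · refine mul_nonneg (prod_nonneg fun i _ => ?_) (prod_nonneg fun i _ => by linarith)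
            split_ifs <;> positivity
      _ = Real.exp (-(l * p * #L)) *
            ∏ i ∈ K, (if i ∈ L then p * Real.exp l + (1 - p) else 1) := by
          rw [← prod_add]
          congr 1
          refine prod_congr rfl fun i _ => ?_
          split_ifs <;> ring
      _ = Real.exp (-(l * p * #L)) * (p * Real.exp l + (1 - p)) ^ #L := by
          rw [prod_ite_mem, inter_eq_right.2 hL, prod_const]
      _ ≤ Real.exp (-(l * p * #L)) * Real.exp (l * p + l ^ 2) ^ #L := by
          have := bernoulli_mgf_le hp0 hp1 l
          have : 0 ≤ p * Real.exp l + (1 - p) := by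
            have := Real.exp_pos l
            nlinarith [mul_nonneg hp0 this.le]
          gcongr
      _ = Real.exp (l ^ 2 * #L) := by
          rw [← Real.exp_nat_mul, ← Real.exp_add]
          ring_nf
  have hS : 0 ≤ ∑ H ∈ powersetCard T K, Real.exp (l * (#(H ∩ L) - p * #L)) :=
    sum_nonneg fun _ _ => (Real.exp_pos _).le
  calc _ ≤ ((#K : ℝ) + 1) * ((#K).choose T * p ^ T * (1 - p) ^ (#K - T)) *
        ∑ H ∈ powersetCard T K, Real.exp (l * (#(H ∩ L) - p * #L)) :=
        le_mul_of_one_le_left hS hm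
    _ = (#K + 1) * (#K).choose T * (p ^ T * (1 - p) ^ (#K - T) *
        ∑ H ∈ powersetCard T K, Real.exp (l * (#(H ∩ L) - p * #L))) := by ring
    _ ≤ _ := by gcongr

/-- Concentration of the hypergeometric distribution: among the `T`-element subsets of `K` few meet
`L` in a number of elements that is off by more than `s`. -/
theorem card_hypergeometric_tail_le {K L : Finset ι} {T : ℕ} (hL : L ⊆ K) (hL0 : L.Nonempty)
    (hT : T ≤ #K) {s : ℝ} (hs : 0 ≤ s) :
    (#{H ∈ powersetCard T K | s ≤ |(#(H ∩ L) : ℝ) - T / #K * #L|} : ℝ) ≤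
      2 * ((#K + 1) * (#K).choose T) * Real.exp (-(s ^ 2 / (4 * #L))) := by
  have hK : 0 < #K := card_pos.2 (hL0.mono hL)
  have hL' : (0 : ℝ) < #L := by exact_mod_cast card_pos.2 hL0
  -- This `l` minimises the exponent `l ^ 2 * #L - l * s` of the Chernoff bound.
  set l : ℝ := s / (2 * #L) with hl
  have hl0 : 0 ≤ l := by positivity
  have h1 := sum_powersetCard_exp_le hL hK hT l
  have h2 := sum_powersetCard_exp_le hL hK hT (-l)
  have h3 : (#{H ∈ powersetCard T K | s ≤ |(#(H ∩ L) : ℝ) - T / #K * #L|} : ℝ) *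
      Real.exp (l * s) ≤ ∑ H ∈ powersetCard T K, (Real.exp (l * (#(H ∩ L) - T / #K * #L)) +
        Real.exp (-l * (#(H ∩ L) - T / #K * #L))) := by
    rw [← nsmul_eq_mul, ← sum_const]
    refine (sum_le_sum fun H hH => ?_).trans
      (sum_le_sum_of_subset_of_nonneg (filter_subset _ _) fun _ _ _ => by positivity)
    have hH' := (mem_filter.1 hH).2
    rcases le_abs.1 hH' with h | h
    · have := Real.exp_le_exp.2 (mul_le_mul_of_nonneg_left h hl0)
      linarith [Real.exp_pos (-l * ((#(H ∩ L) : ℝ) - T / #K * #L))]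
    · have := Real.exp_le_exp.2 (mul_le_mul_of_nonneg_left h hl0)
      rw [mul_neg, ← neg_mul] at this
      linarith [Real.exp_pos (l * ((#(H ∩ L) : ℝ) - T / #K * #L))]
  rw [sum_add_distrib] at h3
  rw [neg_sq] at h2
  have h4 := h3.trans (add_le_add h1 h2)
  rw [← le_div_iff₀ (Real.exp_pos _)] at h4
  refine h4.trans (le_of_eq ?_)
  have e : -(s ^ 2 / (4 * #L)) = l ^ 2 * #L - l * s := by
    rw [hl]
    field_simp
    ring
  rw [e, Real.exp_sub]
  ring

end Hypergeometric

/-! ### Counting sets that meet a given set -/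

theorem choose_sub_mul_pow_le {b r j : ℕ} (hr : r ≤ b) (hj : j ≤ r) :
    (b - j).choose (r - j) * b ^ j ≤ b.choose r * r ^ j := by
  induction j with
  | zero => simp
  | succ j ih =>
    have ih := ih (by omega)
    have h1 : (b - j) * (b - (j + 1)).choose (r - (j + 1)) = (b - j).choose (r - j) * (r - j) := by
      have := Nat.add_one_mul_choose_eq (b - (j + 1)) (r - (j + 1))
      rwa [show b - (j + 1) + 1 = b - j by omega, show r - (j + 1) + 1 = r - j by omega] at this
    have h2 : (r - j) * b ≤ r * (b - j) := by
      rw [Nat.sub_mul, Nat.mul_sub]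
      have : r * j ≤ j * b := by rw [mul_comm]; exact Nat.mul_le_mul_left _ hr
      omega
    have h3 : (b - (j + 1)).choose (r - (j + 1)) * b ≤ (b - j).choose (r - j) * r := by
      refine Nat.le_of_mul_le_mul_left (c := b - j) ?_ (by omega)
      calc (b - j) * ((b - (j + 1)).choose (r - (j + 1)) * b)
          = (b - j).choose (r - j) * ((r - j) * b) := by rw [← mul_assoc, h1, mul_assoc]
        _ ≤ (b - j).choose (r - j) * (r * (b - j)) := Nat.mul_le_mul_left _ h2
        _ = _ := by ring
    calc (b - (j + 1)).choose (r - (j + 1)) * b ^ (j + 1)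
        = ((b - (j + 1)).choose (r - (j + 1)) * b) * b ^ j := by ring
      _ ≤ ((b - j).choose (r - j) * r) * b ^ j := Nat.mul_le_mul_right _ h3
      _ = ((b - j).choose (r - j) * b ^ j) * r := by ring
      _ ≤ (b.choose r * r ^ j) * r := Nat.mul_le_mul_right _ ih
      _ = _ := by ring

section Sets

variable {X : Type*} [DecidableEq X]

theorem card_filter_superset_mul_pow_le {B : Finset X} {r : ℕ} (hr : r ≤ #B) (J : Finset X) :
    #{S ∈ powersetCard r B | J ⊆ S} * #B ^ #J ≤ (#B).choose r * r ^ #J := by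
  by_cases hJ : J ⊆ B ∧ #J ≤ r
  · refine (Nat.mul_le_mul_right _ ?_).trans (choose_sub_mul_pow_le hr hJ.2)
    rw [← card_sdiff_of_subset hJ.1, ← card_powersetCard]
    refine card_le_card_of_injOn (fun S => S \ J) (fun S hS => ?_) fun S hS S' hS' h => ?_
    · have hS := mem_filter.1 (mem_coe.1 hS)
      have h1 := mem_powersetCard.1 hS.1
      refine mem_coe.2 (mem_powersetCard.2 ⟨sdiff_subset_sdiff h1.1 subset_rfl, ?_⟩)
      rw [card_sdiff_of_subset hS.2, h1.2]
    · have h1 := (mem_filter.1 (mem_coe.1 hS)).2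
      have h2 := (mem_filter.1 (mem_coe.1 hS')).2
      rw [← sdiff_union_of_subset h1, ← sdiff_union_of_subset h2]
      exact congrArg (· ∪ J) h
  · have : {S ∈ powersetCard r B | J ⊆ S} = ∅ := by
      refine filter_eq_empty_iff.2 fun S hS hJS => hJ ?_
      have h1 := mem_powersetCard.1 hS
      exact ⟨hJS.trans h1.1, (card_le_card hJS).trans h1.2.le⟩
    simp [this]

theorem sum_powersetCard_pow_card_inter_le {B : Finset X} {r : ℕ} (hr : r ≤ #B) (hB : 0 < #B)
    (U : Finset X) {x : ℝ} (hx : 0 ≤ x) :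
    ∑ S ∈ powersetCard r B, x ^ #(S ∩ U) ≤
      (#B).choose r * Real.exp (x * r * #U / #B) := by
  have hB' : (0 : ℝ) < #B := by exact_mod_cast hB
  have h1 : ∀ S : Finset X, x ^ #(S ∩ U) ≤ ∑ J ∈ U.powerset, if J ⊆ S then x ^ #J else 0 := by
    intro S
    have e : ∑ J ∈ U.powerset, (if J ⊆ S then x ^ #J else 0) =
        ∑ J ∈ (S ∩ U).powerset, x ^ #J := by
      rw [← sum_filter]
      refine sum_congr ?_ fun _ _ => rfl
      ext J
      rw [mem_filter, mem_powerset, mem_powerset, subset_inter_iff, and_comm]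
    rw [e]
    exact single_le_sum (f := fun J => x ^ #J) (fun _ _ => by positivity) (mem_powerset_self _)
  calc ∑ S ∈ powersetCard r B, x ^ #(S ∩ U)
      ≤ ∑ S ∈ powersetCard r B, ∑ J ∈ U.powerset, if J ⊆ S then x ^ #J else 0 :=
        sum_le_sum fun S _ => h1 S
    _ = ∑ J ∈ U.powerset, #{S ∈ powersetCard r B | J ⊆ S} * x ^ #J := by
        rw [sum_comm]
        refine sum_congr rfl fun J _ => ?_
        rw [← sum_filter, sum_const, nsmul_eq_mul]
    _ ≤ ∑ J ∈ U.powerset, (#B).choose r * (x * r / #B) ^ #J := by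
        refine sum_le_sum fun J _ => ?_
        have h := card_filter_superset_mul_pow_le hr J
        have h' : (#{S ∈ powersetCard r B | J ⊆ S} : ℝ) * (#B : ℝ) ^ #J ≤
            (#B).choose r * (r : ℝ) ^ #J := by exact_mod_cast h
        rw [← le_div_iff₀ (by positivity)] at h'
        calc _ ≤ ((#B).choose r * (r : ℝ) ^ #J / (#B : ℝ) ^ #J) * x ^ #J := by gcongr
          _ = _ := by rw [div_pow, mul_pow]; ring
    _ = (#B).choose r * (x * r / #B + 1) ^ #U := by
        rw [← mul_sum, ← sum_pow_mul_eq_add_pow]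
        simp
    _ ≤ (#B).choose r * Real.exp (x * r / #B) ^ #U := by
        gcongr
        exact Real.add_one_le_exp _
    _ = _ := by
        rw [← Real.exp_nat_mul]
        congr 2
        ring

/-! ### The upper tail -/

variable {ι : Type*} [Fintype ι] [DecidableEq ι]

/-- Moments by sequential conditioning. Here `E U` is the set of the bits seen once all bits inside
`U` are revealed; if the conditional expectation of `∑ y S` never exceeds `Z` as long as at most `u`
elements are touched, then the `k`-th moment is at most `Z ^ k` for `k r ≤ u`. The weight `f`, which
records the sets chosen so far, makes the induction work. -/
theorem expect_mul_sum_pow_le {E : Finset X → Finset ι} (hE : Monotone E)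
    {𝒮 : Finset (Finset X)} {r : ℕ} (hr : ∀ S ∈ 𝒮, #S = r) {y : Finset X → (ι → Bool) → ℝ}
    (hy0 : ∀ S ω, 0 ≤ y S ω) (hyd : ∀ S, DependsOn (y S) (E S : Set ι)) {Z : ℝ} (hZ0 : 0 ≤ Z)
    {u : ℕ} (hZ : ∀ U : Finset X, #U ≤ u → ∀ ω,
      ∑ S ∈ 𝒮, 𝔼 ω', y S ((E U).piecewise ω ω') ≤ Z)
    (k : ℕ) (U : Finset X) (hU : #U + k * r ≤ u) (f : (ι → Bool) → ℝ) (hf0 : ∀ ω, 0 ≤ f ω)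
    (hfd : DependsOn f (E U : Set ι)) :
    𝔼 ω, f ω * (∑ S ∈ 𝒮, y S ω) ^ k ≤ (𝔼 ω, f ω) * Z ^ k := by
  induction k generalizing U f with
  | zero => simp
  | succ k ih =>
    have h1 : ∀ ω, f ω * (∑ S ∈ 𝒮, y S ω) ^ (k + 1) =
        ∑ S ∈ 𝒮, (f ω * y S ω) * (∑ S ∈ 𝒮, y S ω) ^ k := by
      intro ω
      rw [pow_succ', ← sum_mul, ← mul_sum, mul_assoc]
    have hkU : k * r + r + #U ≤ u := by
      have : (k + 1) * r = k * r + r := by ring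
      omega
    calc 𝔼 ω, f ω * (∑ S ∈ 𝒮, y S ω) ^ (k + 1)
        = ∑ S ∈ 𝒮, 𝔼 ω, (f ω * y S ω) * (∑ S ∈ 𝒮, y S ω) ^ k := by
          simp_rw [h1]
          rw [expect_sum_comm]
      _ ≤ ∑ S ∈ 𝒮, (𝔼 ω, f ω * y S ω) * Z ^ k := by
          refine sum_le_sum fun S hS => ih (U ∪ S) ?_ _ (fun ω => mul_nonneg (hf0 ω) (hy0 S ω)) ?_
          · have := card_union_le U S
            rw [hr S hS] at this
            omega
          · intro ω ω' h
            have hU : E U ⊆ E (U ∪ S) := hE subset_union_left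
            have hS : E S ⊆ E (U ∪ S) := hE subset_union_right
            change f ω * y S ω = f ω' * y S ω'
            rw [hfd fun i hi => h i (hU hi), hyd S fun i hi => h i (hS hi)]
      _ = (𝔼 ω, f ω * ∑ S ∈ 𝒮, y S ω) * Z ^ k := by
          rw [← sum_mul, ← expect_sum_comm]
          simp_rw [mul_sum]
      _ ≤ ((𝔼 ω, f ω) * Z) * Z ^ k := by
          refine mul_le_mul_of_nonneg_right ?_ (by positivity)
          refine expect_mul_le_of_cond_le hfd hf0 fun ω => ?_
          rw [expect_sum_comm]
          exact hZ U (by omega) ω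
      _ = _ := by ring

/-- The same for sets `S ⊆ B` of size `r`, when the conditional expectation of `y S` given the bits
inside `U` is at most `x ^ #(S ∩ U) P`. -/
theorem expect_sum_powersetCard_pow_le {E : Finset X → Finset ι} (hE : Monotone E)
    {y : Finset X → (ι → Bool) → ℝ} (hy0 : ∀ S ω, 0 ≤ y S ω)
    (hyd : ∀ S, DependsOn (y S) (E S : Set ι)) {r : ℕ} {x P : ℝ} (hx : 0 ≤ x) (hP : 0 ≤ P)
    (hy : ∀ S U : Finset X, #S = r → ∀ ω,
      𝔼 ω', y S ((E U).piecewise ω ω') ≤ x ^ #(S ∩ U) * P)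
    {B : Finset X} (hrB : r ≤ #B) (hB : 0 < #B) (k : ℕ) :
    𝔼 ω, (∑ S ∈ powersetCard r B, y S ω) ^ k ≤
      ((#B).choose r * P * Real.exp (x * r * (k * r) / #B)) ^ k := by
  have hB' : (0 : ℝ) < #B := by exact_mod_cast hB
  have := expect_mul_sum_pow_le hE (𝒮 := powersetCard r B) (r := r) (u := k * r)
    (Z := (#B).choose r * P * Real.exp (x * r * (k * r) / #B))
    (fun S hS => (mem_powersetCard.1 hS).2) hy0 hyd (by positivity) ?_ k ∅ (by simp)
    (fun _ => 1) (fun _ => zero_le_one) fun _ _ _ => rfl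
  · simpa using this
  · intro U hU ω
    have hU' : (#U : ℝ) ≤ k * r := by exact_mod_cast hU
    calc ∑ S ∈ powersetCard r B, 𝔼 ω', y S ((E U).piecewise ω ω')
        ≤ ∑ S ∈ powersetCard r B, x ^ #(S ∩ U) * P :=
          sum_le_sum fun S hS => hy S U (mem_powersetCard.1 hS).2 ω
      _ ≤ ((#B).choose r * Real.exp (x * r * #U / #B)) * P := by
          rw [← sum_mul]
          exact mul_le_mul_of_nonneg_right (sum_powersetCard_pow_card_inter_le hrB hB U hx) hP
      _ ≤ ((#B).choose r * Real.exp (x * r * (k * r) / #B)) * P := by gcongr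
      _ = _ := by ring

theorem expect_indicator_le_div_pow {f : (ι → Bool) → ℝ} (hf : ∀ ω, 0 ≤ f ω) {a M : ℝ}
    (ha : 0 < a) {k : ℕ} (hM : 𝔼 ω, f ω ^ k ≤ M ^ k) :
    𝔼 ω, (if a ≤ f ω then (1 : ℝ) else 0) ≤ (M / a) ^ k := by
  rw [div_pow, le_div_iff₀ (by positivity), expect_mul]
  refine (expect_le_expect fun ω _ => ?_).trans hM
  split_ifs with h
  · rw [one_mul]
    exact pow_le_pow_left₀ ha.le h _
  · simpa using pow_nonneg (hf ω) k

/-! ### The lower tail -/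

theorem exp_neg_le_quadratic {z : ℝ} (hz : 0 ≤ z) : Real.exp (-z) ≤ 1 - z + z ^ 2 / 2 := by
  have h1 := Real.quadratic_le_exp_of_nonneg hz
  rw [Real.exp_neg, inv_le_iff_one_le_mul₀ (Real.exp_pos z)]
  have h2 : 0 ≤ 1 - z + z ^ 2 / 2 := by nlinarith [sq_nonneg (z - 1)]
  nlinarith [mul_le_mul_of_nonneg_left h1 h2, sq_nonneg (z ^ 2)]

/-- The Laplace transform of a nonnegative variable whose second moment is at most `2 a ^ 2` and whose
mean is nearly `a`. -/
theorem expect_exp_neg_le {f : (ι → Bool) → ℝ} (hf : ∀ ω, 0 ≤ f ω) {a η θ : ℝ} (ha : 0 < a)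
    (hθ : 0 ≤ θ) (h1 : (1 - η) * a ≤ 𝔼 ω, f ω) (h2 : 𝔼 ω, f ω ^ 2 ≤ 2 * a ^ 2) :
    𝔼 ω, Real.exp (-(θ / a * f ω)) ≤ Real.exp (-(θ * (1 - η)) + θ ^ 2) := by
  have hl : 0 ≤ θ / a := by positivity
  have h3 : 𝔼 ω, Real.exp (-(θ / a * f ω)) ≤
      1 - θ / a * 𝔼 ω, f ω + (θ / a) ^ 2 / 2 * 𝔼 ω, f ω ^ 2 := by
    rw [mul_expect, mul_expect, ← Fintype.expect_const (ι := ι → Bool) (1 : ℝ),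
      ← expect_sub_distrib, ← expect_add_distrib]
    refine expect_le_expect fun ω _ => (exp_neg_le_quadratic (mul_nonneg hl (hf ω))).trans ?_
    rw [mul_pow]
    exact le_of_eq (by ring)
  have h4 : θ * (1 - η) ≤ θ / a * 𝔼 ω, f ω := by
    calc θ * (1 - η) = θ / a * ((1 - η) * a) := by field_simp
      _ ≤ _ := mul_le_mul_of_nonneg_left h1 hl
  have h5 : (θ / a) ^ 2 / 2 * 𝔼 ω, f ω ^ 2 ≤ θ ^ 2 := by
    calc (θ / a) ^ 2 / 2 * 𝔼 ω, f ω ^ 2 ≤ (θ / a) ^ 2 / 2 * (2 * a ^ 2) := by gcongr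
      _ = θ ^ 2 := by field_simp
  refine h3.trans ((?_ : _ ≤ (-(θ * (1 - η)) + θ ^ 2) + 1).trans (Real.add_one_le_exp _))
  linarith

/-- The image of a fixed set under a uniformly random permutation is a uniformly random set of the
same size. -/
theorem expect_perm_map_eq [Fintype X] {S₀ : Finset X} {r : ℕ} (hS₀ : #S₀ = r)
    (g : Finset X → ℝ) :
    𝔼 σ : Equiv.Perm X, g (S₀.map σ.toEmbedding) = 𝔼 S ∈ powersetCard r univ, g S := by
  have hne : (powersetCard r (univ : Finset X)).Nonempty :=
    ⟨S₀, mem_powersetCard.2 ⟨subset_univ _, hS₀⟩⟩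
  have h1 : ∀ S ∈ powersetCard r (univ : Finset X),
      𝔼 σ : Equiv.Perm X, g (S.map σ.toEmbedding) =
        𝔼 σ : Equiv.Perm X, g (S₀.map σ.toEmbedding) := by
    intro S hS
    have hc : #S₀ = #S := by rw [hS₀, (mem_powersetCard.1 hS).2]
    let e : {x // x ∈ S₀} ≃ {x // x ∈ S} := Finset.equivOfCardEq hc
    let τ : Equiv.Perm X := e.extendSubtype
    have hτ : S₀.map τ.toEmbedding = S := by
      refine eq_of_subset_of_card_le (fun z hz => ?_) (by rw [card_map, hc])
      obtain ⟨w, hw, rfl⟩ := mem_map.1 hz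
      change e.extendSubtype w ∈ S
      rw [Equiv.extendSubtype_apply_of_mem e w hw]
      exact (e ⟨w, hw⟩).2
    rw [← hτ]
    refine Fintype.expect_equiv (Equiv.mulRight τ) _ _ fun σ => ?_
    rw [map_map]
    rfl
  have h2 : ∀ σ : Equiv.Perm X,
      𝔼 S ∈ powersetCard r univ, g (S.map σ.toEmbedding) = 𝔼 S ∈ powersetCard r univ, g S := by
    intro σ
    refine expect_equiv σ.finsetCongr (fun S => ?_) fun S _ => rfl
    simp [mem_powersetCard]
  calc 𝔼 σ : Equiv.Perm X, g (S₀.map σ.toEmbedding)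
      = 𝔼 S ∈ powersetCard r (univ : Finset X), 𝔼 σ : Equiv.Perm X, g (S.map σ.toEmbedding) := by
        rw [expect_congr rfl h1, expect_const hne]
    _ = 𝔼 σ : Equiv.Perm X, 𝔼 S ∈ powersetCard r univ, g S := by
        rw [expect_comm]
        exact expect_congr rfl fun σ _ => h2 σ
    _ = _ := Fintype.expect_const _

theorem exists_disjoint_blocks [Fintype X] {m s : ℕ} (h : m * s ≤ Fintype.card X) :
    ∃ Bl : Fin m → Finset X, (∀ b, #(Bl b) = s) ∧ Pairwise fun b b' => Disjoint (Bl b) (Bl b') := by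
  obtain ⟨φ⟩ := Function.Embedding.nonempty_of_card_le
    (show Fintype.card (Fin m × Fin s) ≤ Fintype.card X by simpa using h)
  refine ⟨fun b => univ.image fun i => φ (b, i), fun b => ?_, fun b b' hb => ?_⟩
  · rw [card_image_of_injective _ fun i j hij => by simpa using φ.injective hij]
    simp
  · refine disjoint_left.2 ?_
    intro z hz hz'
    obtain ⟨i, -, rfl⟩ := mem_image.1 hz
    obtain ⟨j, -, hj⟩ := mem_image.1 hz'
    exact hb (congrArg Prod.fst (φ.injective hj)).symm

/-- The lower tail. Hoeffding's averaging device: the sum over all `r`-sets is an average, over the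
permutations of `X`, of sums over the `r`-sets that lie inside one of `m` disjoint blocks of size
`s`. The blocks contribute independently, and a nonnegative variable has an exponential lower tail
as soon as its second moment is bounded by a multiple of the square of its mean. -/
theorem expect_lower_tail_le [Fintype X] {E : Finset X → Finset ι}
    (hEd : ∀ B B', Disjoint B B' → Disjoint (E B) (E B')) (hE : Monotone E)
    {y : Finset X → (ι → Bool) → ℝ} (hy0 : ∀ S ω, 0 ≤ y S ω)
    (hyd : ∀ S, DependsOn (y S) (E S : Set ι)) {r m s : ℕ} (hms : m * s ≤ Fintype.card X)
    (hr : r ≤ Fintype.card X) {P η δ θ : ℝ}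
    (hP : 0 < (s.choose r : ℝ) * P) (hθ : 0 ≤ θ)
    (h1 : ∀ B : Finset X, #B = s →
      (1 - η) * (s.choose r * P) ≤ 𝔼 ω, ∑ S ∈ powersetCard r B, y S ω)
    (h2 : ∀ B : Finset X, #B = s →
      𝔼 ω, (∑ S ∈ powersetCard r B, y S ω) ^ 2 ≤ 2 * (s.choose r * P) ^ 2) :
    𝔼 ω, (if ∑ S ∈ powersetCard r univ, y S ω ≤ (1 - δ) * ((Fintype.card X).choose r * P)
      then (1 : ℝ) else 0) ≤ Real.exp (-(m * (θ * (δ - η) - θ ^ 2))) := by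
  classical
  obtain ⟨Bl, hBs, hBd⟩ := exists_disjoint_blocks (X := X) hms
  set a : ℝ := s.choose r * P with ha
  set Y : Finset X → (ι → Bool) → ℝ := fun B ω => ∑ S ∈ powersetCard r B, y S ω with hY
  have hY0 : ∀ B ω, 0 ≤ Y B ω := fun B ω => sum_nonneg fun S _ => hy0 S ω
  have hYd : ∀ B, DependsOn (Y B) (E B : Set ι) := by
    intro B ω ω' h
    refine sum_congr rfl fun S hS => hyd S fun i hi => h i ?_
    have hSB : E S ⊆ E B := hE (mem_powersetCard.1 hS).1
    exact hSB hi
  have hC : (0 : ℝ) < (Fintype.card X).choose r := by exact_mod_cast Nat.choose_pos hr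
  have havg : ∀ ω, 𝔼 σ : Equiv.Perm X, ∑ b, Y ((Bl b).map σ.toEmbedding) ω =
      m * (s.choose r * ((Y univ ω) / (Fintype.card X).choose r)) := by
    intro ω
    rw [expect_sum_comm]
    have : ∀ b, 𝔼 σ : Equiv.Perm X, Y ((Bl b).map σ.toEmbedding) ω =
        s.choose r * ((Y univ ω) / (Fintype.card X).choose r) := by
      intro b
      have e1 : ∀ σ : Equiv.Perm X, Y ((Bl b).map σ.toEmbedding) ω =
          ∑ S₀ ∈ powersetCard r (Bl b), y (S₀.map σ.toEmbedding) ω := by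
        intro σ
        simp only [hY]
        rw [powersetCard_map, sum_map]
        rfl
      simp_rw [e1]
      rw [expect_sum_comm, sum_congr rfl fun S₀ hS₀ =>
        expect_perm_map_eq (mem_powersetCard.1 hS₀).2 fun S => y S ω]
      rw [sum_const, card_powersetCard, hBs, nsmul_eq_mul, expect_eq_sum_div_card,
        card_powersetCard, card_univ]
    simp [this]
  have hblock : ∀ σ : Equiv.Perm X,
      𝔼 ω, Real.exp (-(θ / a * ∑ b, Y ((Bl b).map σ.toEmbedding) ω)) ≤
        Real.exp (m * (-(θ * (1 - η)) + θ ^ 2)) := by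
    intro σ
    have e1 : ∀ ω, Real.exp (-(θ / a * ∑ b, Y ((Bl b).map σ.toEmbedding) ω)) =
        ∏ b, Real.exp (-(θ / a * Y ((Bl b).map σ.toEmbedding) ω)) := by
      intro ω
      rw [← Real.exp_sum, mul_sum, ← sum_neg_distrib]
    simp_rw [e1]
    rw [expect_prod_of_dependsOn univ (F := fun b => E ((Bl b).map σ.toEmbedding))]
    · calc ∏ b, 𝔼 ω, Real.exp (-(θ / a * Y ((Bl b).map σ.toEmbedding) ω))
          ≤ ∏ _b : Fin m, Real.exp (-(θ * (1 - η)) + θ ^ 2) := by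
            refine prod_le_prod (fun b _ => expect_nonneg fun _ _ => (Real.exp_pos _).le)
              fun b _ => ?_
            have hs : #((Bl b).map σ.toEmbedding) = s := by rw [card_map, hBs]
            exact expect_exp_neg_le (hY0 _) hP hθ (h1 _ hs) (h2 _ hs)
        _ = _ := by rw [prod_const, card_univ, Fintype.card_fin, ← Real.exp_nat_mul]
    · intro b _ ω ω' h
      simp only [hYd _ h]
    · intro b _ b' _ hb
      exact hEd _ _ ((disjoint_map _).2 (hBd hb))
  have hjensen : ∀ ω, Real.exp (-(θ / a * (m * (s.choose r * ((Y univ ω) /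
      (Fintype.card X).choose r))))) ≤
      𝔼 σ : Equiv.Perm X, Real.exp (-(θ / a * ∑ b, Y ((Bl b).map σ.toEmbedding) ω)) := by
    intro ω
    rw [← havg, mul_expect, ← expect_neg_distrib]
    set n : ℝ := (Fintype.card (Equiv.Perm X) : ℝ)
    have hn : (0 : ℝ) < n := by simp only [n]; exact_mod_cast Fintype.card_pos
    have := convexOn_exp.map_sum_le (t := (univ : Finset (Equiv.Perm X)))
      (w := fun _ => n⁻¹) (p := fun σ => -(θ / a * ∑ b, Y ((Bl b).map σ.toEmbedding) ω))
      (fun _ _ => by positivity) (by simp [n]) fun _ _ => Set.mem_univ _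
    rw [Fintype.expect_eq_sum_div_card, Fintype.expect_eq_sum_div_card]
    simpa [← mul_sum, div_eq_inv_mul] using this
  have hmain : (𝔼 ω, (if Y univ ω ≤ (1 - δ) * ((Fintype.card X).choose r * P)
      then (1 : ℝ) else 0)) * Real.exp (-(m * (θ * (1 - δ)))) ≤
      Real.exp (m * (-(θ * (1 - η)) + θ ^ 2)) := by
    rw [expect_mul]
    calc _ ≤ 𝔼 ω, 𝔼 σ : Equiv.Perm X,
          Real.exp (-(θ / a * ∑ b, Y ((Bl b).map σ.toEmbedding) ω)) := by
          refine expect_le_expect fun ω _ => le_trans ?_ (hjensen ω)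
          split_ifs with h
          · rw [one_mul, Real.exp_le_exp, neg_le_neg_iff]
            have h' : Y univ ω / (Fintype.card X).choose r ≤ (1 - δ) * P := by
              rw [div_le_iff₀ hC]
              linarith
            calc θ / a * (m * (s.choose r * (Y univ ω / (Fintype.card X).choose r)))
                ≤ θ / a * (m * (s.choose r * ((1 - δ) * P))) := by gcongr
              _ = m * (θ * (1 - δ)) * (a / a) := by rw [ha]; ring
              _ = _ := by rw [div_self hP.ne', mul_one]
          · rw [zero_mul]
            exact (Real.exp_pos _).le
      _ = 𝔼 σ : Equiv.Perm X, 𝔼 ω,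
          Real.exp (-(θ / a * ∑ b, Y ((Bl b).map σ.toEmbedding) ω)) := expect_comm _ _ _
      _ ≤ 𝔼 σ : Equiv.Perm X, Real.exp (m * (-(θ * (1 - η)) + θ ^ 2)) :=
          expect_le_expect fun σ _ => hblock σ
      _ = _ := Fintype.expect_const _
  rw [← le_div_iff₀ (Real.exp_pos _), ← Real.exp_sub] at hmain
  refine hmain.trans (le_of_eq ?_)
  congr 1
  ring

end Sets

/-! ### Quasicliques in terms of random bits -/

section Pairs

variable {V : Type*} [DecidableEq V]

/-- The pairs of distinct elements of `S`, as elements of `Sym2 V`. -/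
def pairs (S : Finset V) : Finset (Sym2 V) := S.sym2.filter fun e => ¬ e.IsDiag

/-- The pairs of distinct elements of `S` that contain `v`. -/
def star (S : Finset V) (v : V) : Finset (Sym2 V) := (pairs S).filter fun e => v ∈ e

theorem mk_mem_pairs {S : Finset V} {a b : V} : s(a, b) ∈ pairs S ↔ (a ∈ S ∧ b ∈ S) ∧ a ≠ b := by
  simp [pairs]

theorem pairs_subset_sym2 (S : Finset V) : pairs S ⊆ S.sym2 := filter_subset _ _

theorem pairs_mono {S S' : Finset V} (h : S ⊆ S') : pairs S ⊆ pairs S' :=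
  filter_subset_filter _ (sym2_mono h)

theorem card_pairs (S : Finset V) : #(pairs S) = (#S).choose 2 := by
  rw [← Sym2.card_image_offDiag]
  congr 1
  ext e
  induction e with
  | _ a b =>
    simp only [mk_mem_pairs, mem_image, mem_offDiag, Prod.exists]
    constructor
    · rintro ⟨⟨ha, hb⟩, hab⟩
      exact ⟨a, b, ⟨ha, hb, hab⟩, rfl⟩
    · rintro ⟨x, y, ⟨hx, hy, hxy⟩, h⟩
      rcases Sym2.eq_iff.1 h with ⟨rfl, rfl⟩ | ⟨rfl, rfl⟩
      · exact ⟨⟨hx, hy⟩, hxy⟩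
      · exact ⟨⟨hy, hx⟩, hxy.symm⟩

theorem star_eq_image {S : Finset V} {v : V} (hv : v ∈ S) :
    star S v = (S.erase v).image fun u => s(v, u) := by
  ext e
  induction e with
  | _ a b =>
    simp only [star, mem_filter, mk_mem_pairs, mem_image, mem_erase, Sym2.mem_iff]
    constructor
    · rintro ⟨⟨⟨ha, hb⟩, hab⟩, rfl | rfl⟩
      · exact ⟨b, ⟨hab.symm, hb⟩, rfl⟩
      · exact ⟨a, ⟨hab, ha⟩, Sym2.eq_swap⟩
    · rintro ⟨u, ⟨huv, hu⟩, h⟩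
      rcases Sym2.eq_iff.1 h with ⟨rfl, rfl⟩ | ⟨rfl, rfl⟩
      · exact ⟨⟨⟨hv, hu⟩, huv.symm⟩, Or.inl rfl⟩
      · exact ⟨⟨⟨hu, hv⟩, huv⟩, Or.inr rfl⟩

theorem card_star {S : Finset V} {v : V} (hv : v ∈ S) : #(star S v) = #S - 1 := by
  rw [star_eq_image hv, card_image_of_injective _ fun a b h => Sym2.congr_right.1 h,
    card_erase_of_mem hv]

theorem star_subset_pairs (S : Finset V) (v : V) : star S v ⊆ pairs S := filter_subset _ _

theorem card_filter_mem_of_mem_pairs {S : Finset V} {e : Sym2 V} (he : e ∈ pairs S) :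
    #{v ∈ S | v ∈ e} = 2 := by
  induction e with
  | _ a b =>
    obtain ⟨⟨ha, hb⟩, hab⟩ := mk_mem_pairs.1 he
    rw [← card_pair hab]
    congr 1
    ext v
    simp only [mem_filter, Sym2.mem_iff, mem_insert, mem_singleton]
    constructor
    · exact fun h => h.2
    · rintro (rfl | rfl)
      · exact ⟨ha, Or.inl rfl⟩
      · exact ⟨hb, Or.inr rfl⟩

theorem trace_star {ι : Type*} (p : ι → Prop) [DecidablePred p] (K : Finset ι) (ω : ι → Bool) :
    trace (K.filter p) ω = (trace K ω).filter p := by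
  ext i
  simp only [trace, mem_filter]
  tauto

/-- Double counting of the incidences between `D` and the present pairs of `S`. -/
theorem sum_card_trace_star (S D : Finset V) (ω : Sym2 V → Bool) :
    ∑ v ∈ D, #(trace (star S v) ω) = ∑ e ∈ trace (pairs S) ω, #{v ∈ D | v ∈ e} := by
  simp_rw [star, trace_star]
  exact sum_card_bipartiteAbove_eq_sum_card_bipartiteBelow (fun v e => v ∈ e)

theorem sum_card_star (S D : Finset V) :
    ∑ v ∈ D, #(star S v) = ∑ e ∈ pairs S, #{v ∈ D | v ∈ e} :=
  sum_card_bipartiteAbove_eq_sum_card_bipartiteBelow (fun v e => v ∈ e)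

/-- The configuration `ω` induces on `S` a graph with `T` edges all of whose degrees are within
`3 α t / 4` of `(1 / 2 + α) t`. -/
def IsQC (α : ℝ) (t T : ℕ) (S : Finset V) (ω : Sym2 V → Bool) : Prop :=
  #(trace (pairs S) ω) = T ∧
    ∀ v ∈ S, |(#(trace (star S v) ω) : ℝ) - (1 / 2 + α) * t| ≤ 3 * α / 4 * t

theorem trace_congr {ι : Type*} {K : Finset ι} {ω ω' : ι → Bool} (h : ∀ i ∈ K, ω i = ω' i) :
    trace K ω = trace K ω' :=
  filter_congr fun i hi => by rw [h i hi]

theorem IsQC_congr {α : ℝ} {t T : ℕ} {S : Finset V} {ω ω' : Sym2 V → Bool}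
    (h : ∀ e ∈ S.sym2, ω e = ω' e) : IsQC α t T S ω ↔ IsQC α t T S ω' := by
  have h1 : trace (pairs S) ω = trace (pairs S) ω' :=
    trace_congr fun e he => h e (pairs_subset_sym2 S he)
  have h2 : ∀ v, trace (star S v) ω = trace (star S v) ω' := fun v =>
    trace_congr fun e he => h e (pairs_subset_sym2 S (star_subset_pairs S v he))
  simp only [IsQC, h1, h2]

/-- The vertices outside `U` of a quasiclique have large total degree, since those in `U` do not
take up more than their share. -/
theorem IsQC.le_sum_degree {α : ℝ} {t T : ℕ} {S : Finset V} {ω : Sym2 V → Bool}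
    (h : IsQC α t T S ω) (U : Finset V) :
    2 * (T : ℝ) - #(S ∩ U) * ((1 / 2 + α) * t + 3 * α / 4 * t) ≤
      ∑ v ∈ S \ U, (#(trace (star S v) ω) : ℝ) := by
  have h1 : ∑ v ∈ S, (#(trace (star S v) ω) : ℝ) = 2 * T := by
    have := sum_card_trace_star S S ω
    rw [sum_congr rfl fun e (he : e ∈ trace (pairs S) ω) =>
      card_filter_mem_of_mem_pairs (mem_filter.1 he).1, sum_const, h.1, smul_eq_mul] at this
    rw [mul_comm]
    exact_mod_cast this
  have h2 : ∑ v ∈ S ∩ U, (#(trace (star S v) ω) : ℝ) ≤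
      #(S ∩ U) * ((1 / 2 + α) * t + 3 * α / 4 * t) := by
    rw [← nsmul_eq_mul]
    refine sum_le_card_nsmul _ _ _ fun v hv => ?_
    have := (abs_le.1 (h.2 v (mem_inter.1 hv).1)).2
    linarith
  have h3 := sum_inter_add_sum_sdiff S U fun v => (#(trace (star S v) ω) : ℝ)
  linarith

theorem half_exp_add_one_le (z : ℝ) : (Real.exp z + 1) / 2 ≤ Real.exp (z / 2 + z ^ 2 / 8) := by
  have h := Real.cosh_le_exp_half_sq (z / 2)
  rw [Real.cosh_eq] at h
  calc (Real.exp z + 1) / 2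
      = Real.exp (z / 2) * ((Real.exp (z / 2) + Real.exp (-(z / 2))) / 2) := by
        rw [mul_div_assoc', mul_add, ← Real.exp_add, ← Real.exp_add]
        simp
    _ ≤ Real.exp (z / 2) * Real.exp ((z / 2) ^ 2 / 2) := by gcongr
    _ = _ := by
        rw [← Real.exp_add]
        ring_nf

variable [Fintype V]

open Classical in
/-- Whatever the bits inside `U` are, the conditional probability that `S` is a quasiclique is at
most what the Chernoff bound for the total degree of `S \ U` gives; the Chernoff parameter is
`2 α`. -/
theorem expect_isQC_cond_le {α : ℝ} (hα : 0 ≤ α) {t T : ℕ} {S : Finset V} (hS : #S = t)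
    (hT : (1 / 2 + α) * (t.choose 2 : ℝ) - 1 ≤ T) (U : Finset V) (ω₁ : Sym2 V → Bool) :
    𝔼 ω, (if IsQC α t T S (U.sym2.piecewise ω₁ ω) then (1 : ℝ) else 0) ≤
      Real.exp (-(α ^ 2 * t ^ 2) + 2 * α ^ 2 * t + 4 * α + α * #(S ∩ U) +
        7 / 2 * α ^ 2 * #(S ∩ U) * t) := by
  rcases Nat.eq_zero_or_pos t with rfl | ht
  · have hS0 : S = ∅ := card_eq_zero.1 hS
    subst hS0
    calc _ ≤ 𝔼 _ω : Sym2 V → Bool, (1 : ℝ) :=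
          expect_le_expect fun ω _ => by split_ifs <;> norm_num
      _ = 1 := Fintype.expect_const _
      _ ≤ _ := Real.one_le_exp (by simp [hα])
  -- The total degree of `S \ U` is the sum of the bits with the weights `w e ∈ {0, 1, 2}`; the weight
  -- vanishes on the pairs inside `U`, so that only unrevealed bits count.
  set w : Sym2 V → ℕ := fun e => #{v ∈ S \ U | v ∈ e} with hw
  set B : ℝ := 2 * (T : ℝ) - #(S ∩ U) * ((1 / 2 + α) * t + 3 * α / 4 * t) with hB
  set j : ℝ := (#(S ∩ U) : ℝ) with hj
  have hw2 : ∀ e ∈ pairs S, w e ≤ 2 := fun e he => by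
    rw [← card_filter_mem_of_mem_pairs he]
    exact card_le_card (filter_subset_filter _ sdiff_subset)
  have ht1 : (1 : ℝ) ≤ t := by exact_mod_cast ht
  have hjt : j ≤ t := by
    rw [hj, ← hS]
    exact_mod_cast card_le_card inter_subset_left
  have hj0 : 0 ≤ j := Nat.cast_nonneg _
  have hsw : ∑ e ∈ pairs S, (w e : ℝ) = (t - j) * (t - 1) := by
    have h1 := sum_card_star S (S \ U)
    rw [sum_congr rfl fun v hv => card_star (mem_sdiff.1 hv).1, sum_const, smul_eq_mul] at h1
    have h2 : ((#(S \ U) : ℕ) : ℝ) = t - j := by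
      have := card_sdiff_add_card_inter S U
      rw [hj, ← hS, ← this]
      push_cast
      ring
    calc ∑ e ∈ pairs S, (w e : ℝ) = ((#(S \ U) * (#S - 1) : ℕ) : ℝ) := by
          rw [h1]
          push_cast
          rfl
      _ = _ := by rw [Nat.cast_mul, h2, hS, Nat.cast_sub ht, Nat.cast_one]
  have hind : ∀ ω : Sym2 V → Bool,
      (if IsQC α t T S (U.sym2.piecewise ω₁ ω) then (1 : ℝ) else 0) ≤
        Real.exp (-(2 * α * B)) * ∏ e ∈ pairs S,
          (fun e (b : Bool) => if b then Real.exp (2 * α * w e) else 1) e (ω e) := by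
    intro ω
    split_ifs with h
    · have h1 := h.le_sum_degree U
      have h2 : ∑ v ∈ S \ U, (#(trace (star S v) (U.sym2.piecewise ω₁ ω)) : ℝ) =
          ∑ e ∈ pairs S, if ω e then (w e : ℝ) else 0 := by
        have := sum_card_trace_star S (S \ U) (U.sym2.piecewise ω₁ ω)
        rw [← Nat.cast_sum, this, Nat.cast_sum, trace, sum_filter]
        refine sum_congr rfl fun e he => ?_
        by_cases heU : e ∈ U.sym2
        · have : w e = 0 := by
            rw [hw]
            refine card_eq_zero.2 (filter_eq_empty_iff.2 fun v hv hve => ?_)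
            exact (mem_sdiff.1 hv).2 (mem_sym2_iff.1 heU v hve)
          change (if _ then (w e : ℝ) else 0) = _
          simp [this]
        · simp [heU, hw]
      rw [h2] at h1
      change B ≤ _ at h1
      have h3 : ∏ e ∈ pairs S, (if ω e then Real.exp (2 * α * w e) else 1) =
          Real.exp (2 * α * ∑ e ∈ pairs S, if ω e then (w e : ℝ) else 0) := by
        rw [mul_sum, Real.exp_sum]
        refine prod_congr rfl fun e _ => ?_
        split_ifs <;> simp
      change 1 ≤ Real.exp (-(2 * α * B)) * ∏ e ∈ pairs S,
        (if ω e then Real.exp (2 * α * w e) else 1)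
      rw [h3, ← Real.exp_add]
      refine Real.one_le_exp ?_
      have := mul_le_mul_of_nonneg_left h1 (show 0 ≤ 2 * α by linarith)
      linarith
    · refine mul_nonneg (Real.exp_pos _).le (prod_nonneg fun e _ => ?_)
      dsimp only
      split_ifs <;> positivity
  refine (expect_le_expect fun ω _ => hind ω).trans ?_
  rw [← mul_expect, expect_prod_bit (pairs S)
    fun e (b : Bool) => if b then Real.exp (2 * α * w e) else 1]
  have hprod : ∏ e ∈ pairs S, ((if true = true then Real.exp (2 * α * w e) else 1) +
      (if false = true then Real.exp (2 * α * w e) else 1)) / 2 ≤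
      Real.exp (α * ((t - j) * (t - 1)) + α ^ 2 * ((t - j) * (t - 1))) := by
    rw [← hsw, mul_sum, mul_sum, ← sum_add_distrib, Real.exp_sum]
    refine prod_le_prod (fun e _ => by simp; positivity) fun e he => ?_
    have h1 := half_exp_add_one_le (2 * α * w e)
    simp only [if_true, Bool.false_eq_true, if_false]
    refine h1.trans (Real.exp_le_exp.2 ?_)
    have h2 : (w e : ℝ) ≤ 2 := by exact_mod_cast hw2 e he
    have h3 : (0 : ℝ) ≤ w e := Nat.cast_nonneg _
    nlinarith [mul_nonneg (sq_nonneg α) (mul_nonneg h3 (sub_nonneg.2 h2))]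
  refine (mul_le_mul_of_nonneg_left hprod (Real.exp_pos _).le).trans ?_
  rw [← Real.exp_add, Real.exp_le_exp]
  have hN : (t.choose 2 : ℝ) = t * (t - 1) / 2 := Nat.cast_choose_two ℝ t
  have hBl : (1 / 2 + α) * (t * (t - 1)) - 2 - j * ((1 / 2 + α) * t + 3 * α / 4 * t) ≤ B := by
    rw [hB]
    rw [hN] at hT
    linarith
  have h5 := mul_le_mul_of_nonneg_left hBl (show 0 ≤ 2 * α by linarith)
  have h6 : α ^ 2 * ((t - j) * (t - 1)) ≤ α ^ 2 * t ^ 2 := by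
    refine mul_le_mul_of_nonneg_left ?_ (sq_nonneg α)
    nlinarith
  nlinarith

end Pairs

/-! ### The probability that a given set is a quasiclique -/

/-- The probability that `N - w` fair bits contain exactly `T - a` ones. It is the probability that
a set with `N` pairs spans exactly `T` edges, given that `a` of `w` fixed pairs are edges. -/
noncomputable def exactProb (N w T a : ℕ) : ℝ := (N - w).choose (T - a) / 2 ^ (N - w)

theorem exactProb_nonneg (N w T a : ℕ) : 0 ≤ exactProb N w T a := by
  unfold exactProb
  positivity

/-- Revealing a single pair changes the probability of having exactly `T` edges by a factor of at
most `N`, unless it makes the event impossible. -/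
theorem choose_div_le_mul_exactProb {N w T a : ℕ} (hw : w ≤ 1) (ha : a ≤ w) (haT : a ≤ T)
    (hN : 1 ≤ N) (h0 : exactProb N w T a ≠ 0) :
    (N.choose T : ℝ) / 2 ^ N ≤ N * exactProb N w T a := by
  have hN1 : (1 : ℝ) ≤ N := by exact_mod_cast hN
  obtain ⟨N, rfl⟩ : ∃ M, N = M + 1 := ⟨N - 1, by omega⟩
  interval_cases w
  · interval_cases a
    simp only [exactProb, Nat.sub_zero]
    exact le_mul_of_one_le_left (by positivity) hN1
  · have hpow : (2 : ℝ) ^ (N + 1) = 2 * 2 ^ N := pow_succ' 2 N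
    interval_cases a
    · have hT : T ≤ N := by
        by_contra h
        exact h0 (by simp [exactProb, Nat.choose_eq_zero_of_lt (not_le.1 h)])
      have h1 : (N + 1).choose T ≤ (N + 1) * N.choose T := by
        have h4 := Nat.choose_mul_succ_eq N T
        have : 1 ≤ N + 1 - T := by omega
        calc (N + 1).choose T ≤ (N + 1).choose T * (N + 1 - T) := Nat.le_mul_of_pos_right _ this
          _ = _ := by rw [← h4]; ring
      have h1' : ((N + 1).choose T : ℝ) ≤ ((N + 1 : ℕ) : ℝ) * N.choose T := by exact_mod_cast h1
      simp only [exactProb, Nat.add_sub_cancel, Nat.sub_zero]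
      rw [hpow, mul_div_assoc', div_le_div_iff₀ (by positivity) (by positivity)]
      nlinarith [show (0 : ℝ) < 2 ^ N by positivity, mul_nonneg (Nat.cast_nonneg (α := ℝ) (N + 1))
        (mul_nonneg (Nat.cast_nonneg (α := ℝ) (N.choose T)) (show (0 : ℝ) ≤ 2 ^ N by positivity))]
    · obtain ⟨T, rfl⟩ : ∃ M, T = M + 1 := ⟨T - 1, by omega⟩
      have h1 : (N + 1).choose (T + 1) ≤ (N + 1) * N.choose T := by
        rw [Nat.add_one_mul_choose_eq]
        exact Nat.le_mul_of_pos_right _ (Nat.succ_pos _)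
      have h1' : ((N + 1).choose (T + 1) : ℝ) ≤ ((N + 1 : ℕ) : ℝ) * N.choose T := by
        exact_mod_cast h1
      simp only [exactProb, Nat.add_sub_cancel]
      rw [hpow, mul_div_assoc', div_le_div_iff₀ (by positivity) (by positivity)]
      nlinarith [show (0 : ℝ) < 2 ^ N by positivity, mul_nonneg (Nat.cast_nonneg (α := ℝ) (N + 1))
        (mul_nonneg (Nat.cast_nonneg (α := ℝ) (N.choose T)) (show (0 : ℝ) ≤ 2 ^ N by positivity))]

section Probabilities

variable {V : Type*} [DecidableEq V] [Fintype V]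

theorem expect_card_trace_eq {W S : Finset V} (hWS : W ⊆ S) (ω₀ : Sym2 V → Bool) {T : ℕ}
    (ha : #(trace (pairs W) ω₀) ≤ T) :
    𝔼 ω, (if #(trace (pairs S) (W.sym2.piecewise ω₀ ω)) = T then (1 : ℝ) else 0) =
      exactProb #(pairs S) #(pairs W) T #(trace (pairs W) ω₀) := by
  have h1 : ∀ ω, #(trace (pairs S) (W.sym2.piecewise ω₀ ω)) =
      #(trace (pairs W) ω₀) + #(trace (pairs S \ pairs W) ω) := by
    intro ω
    have hpw : ∀ e ∈ pairs S, e ∈ W.sym2 ↔ e ∈ pairs W := by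
      intro e he
      rw [pairs, mem_filter]
      exact ⟨fun h => ⟨h, (mem_filter.1 he).2⟩, fun h => h.1⟩
    rw [← card_union_of_disjoint]
    · congr 1
      ext e
      simp only [trace, mem_filter, mem_union, mem_sdiff]
      by_cases heW : e ∈ pairs W
      · have heS := pairs_mono hWS heW
        simp [heW, heS, pairs_subset_sym2 W heW]
      · by_cases heS : e ∈ pairs S
        · have : e ∉ W.sym2 := fun h => heW ((hpw e heS).1 h)
          simp [heW, heS, this]
        · simp [heS, heW]
    · refine disjoint_of_subset_left (filter_subset _ _)
        (disjoint_of_subset_right (filter_subset _ _) disjoint_sdiff)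
  have h2 : ∀ ω, (if #(trace (pairs S) (W.sym2.piecewise ω₀ ω)) = T then (1 : ℝ) else 0) =
      if trace (pairs S \ pairs W) ω ∈
        powersetCard (T - #(trace (pairs W) ω₀)) (pairs S \ pairs W) then (1 : ℝ) else 0 := by
    intro ω
    rw [h1]
    refine if_congr ?_ rfl rfl
    rw [mem_powersetCard]
    have : trace (pairs S \ pairs W) ω ⊆ pairs S \ pairs W := filter_subset _ _
    simp only [this, true_and]
    omega
  rw [expect_congr rfl fun ω _ => h2 ω, expect_trace_mem fun H hH =>
    mem_powerset.2 (mem_powersetCard.1 hH).1, card_powersetCard, exactProb,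
    card_sdiff_of_subset (pairs_mono hWS)]

open Classical in
theorem expect_isQC_le {W S : Finset V} (hWS : W ⊆ S) (ω₀ : Sym2 V → Bool) {α : ℝ} {t T : ℕ}
    (ha : #(trace (pairs W) ω₀) ≤ T) :
    𝔼 ω, (if IsQC α t T S (W.sym2.piecewise ω₀ ω) then (1 : ℝ) else 0) ≤
      exactProb #(pairs S) #(pairs W) T #(trace (pairs W) ω₀) := by
  rw [← expect_card_trace_eq hWS ω₀ ha]
  refine expect_le_expect fun ω _ => ?_
  by_cases h : IsQC α t T S (W.sym2.piecewise ω₀ ω)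
  · simp [h, h.1]
  · rw [if_neg h]
    split_ifs <;> norm_num

/-- A set with the right number of edges rarely has a vertex whose degree is far off. -/
theorem expect_degree_off_le {S : Finset V} {α : ℝ} (hα1 : α ≤ 1 / 2) {t T : ℕ} (hS : #S = t)
    (ht : 2 ≤ t) (hαt : 16 ≤ α * t) (hT : |(T : ℝ) - (1 / 2 + α) * (t.choose 2 : ℝ)| < 1)
    (hTN : T ≤ t.choose 2) {v : V} (hv : v ∈ S) :
    𝔼 ω, (if #(trace (pairs S) ω) = T ∧
        3 * α / 4 * t < |(#(trace (star S v) ω) : ℝ) - (1 / 2 + α) * t| then (1 : ℝ) else 0) ≤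
      2 * ((t.choose 2 + 1 : ℝ) * ((t.choose 2).choose T / 2 ^ (t.choose 2))) *
        Real.exp (-(α ^ 2 * t / 16)) := by
  have hN : #(pairs S) = t.choose 2 := by rw [card_pairs, hS]
  have hst : #(star S v) = t - 1 := by rw [card_star hv, hS]
  have ht2 : (2 : ℝ) ≤ t := by exact_mod_cast ht
  have hst' : (#(star S v) : ℝ) = t - 1 := by rw [hst, Nat.cast_sub (by omega), Nat.cast_one]
  have hNr : (t.choose 2 : ℝ) = t * (t - 1) / 2 := Nat.cast_choose_two ℝ t
  have hα0 : 0 < α := by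
    by_contra h
    nlinarith [not_lt.1 h]
  set 𝓗 := {H ∈ powersetCard T (pairs S) | 5 / 8 * (α * t) ≤
    |(#(H ∩ star S v) : ℝ) - T / #(pairs S) * #(star S v)|} with h𝓗
  -- The mean degree `T / N * (t - 1)` differs from `(1 / 2 + α) t` only by a rounding error.
  have hmean : |(T : ℝ) / #(pairs S) * #(star S v) - (1 / 2 + α) * t| ≤ 2 := by
    rw [hN, hst', hNr]
    have e : (T : ℝ) / (t * (t - 1) / 2) * (t - 1) - (1 / 2 + α) * t =
        (T - (1 / 2 + α) * (t * (t - 1) / 2)) * (2 / t) - (1 / 2 + α) := by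
      have : (t : ℝ) - 1 ≠ 0 := by linarith
      field_simp
      ring
    rw [e]
    rw [hNr] at hT
    have h1 : |((T : ℝ) - (1 / 2 + α) * (t * (t - 1) / 2)) * (2 / t)| ≤ 1 := by
      rw [abs_mul, abs_of_nonneg (show (0 : ℝ) ≤ 2 / t by positivity)]
      have h3 : (2 : ℝ) / t ≤ 1 := (div_le_one (by linarith)).2 ht2
      have h4 : (0 : ℝ) ≤ 2 / t := by positivity
      nlinarith
    have h2 := abs_le.1 h1
    exact abs_le.2 ⟨by linarith, by linarith⟩
  have hle : ∀ ω, (if #(trace (pairs S) ω) = T ∧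
      3 * α / 4 * t < |(#(trace (star S v) ω) : ℝ) - (1 / 2 + α) * t| then (1 : ℝ) else 0) ≤
      if trace (pairs S) ω ∈ 𝓗 then (1 : ℝ) else 0 := by
    intro ω
    split_ifs with h1 h2 h2
    · exact le_rfl
    · refine absurd ?_ h2
      refine mem_filter.2 ⟨mem_powersetCard.2 ⟨filter_subset _ _, h1.1⟩, ?_⟩
      have e : trace (pairs S) ω ∩ star S v = trace (star S v) ω := by
        rw [star, trace_star, inter_filter, trace, inter_eq_left.2 (filter_subset _ _)]
      rw [e]
      have h3 := abs_sub_le (#(trace (star S v) ω) : ℝ) (T / #(pairs S) * #(star S v))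
        ((1 / 2 + α) * t)
      linarith [h1.2]
    · exact zero_le_one
    · exact le_rfl
  have htail := card_hypergeometric_tail_le (star_subset_pairs S v)
    (card_pos.1 (by omega : 0 < #(star S v))) (T := T) (by rw [hN]; exact hTN)
    (s := 5 / 8 * (α * t)) (by positivity)
  rw [hN] at htail
  calc _ ≤ 𝔼 ω, (if trace (pairs S) ω ∈ 𝓗 then (1 : ℝ) else 0) :=
        expect_le_expect fun ω _ => hle ω
    _ = #𝓗 / 2 ^ (t.choose 2) := by
        rw [expect_trace_mem, hN]
        exact fun H hH => mem_powerset.2 (mem_powersetCard.1 (mem_filter.1 hH).1).1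
    _ ≤ 2 * ((t.choose 2 + 1) * (t.choose 2).choose T) *
          Real.exp (-((5 / 8 * (α * t)) ^ 2 / (4 * #(star S v)))) / 2 ^ (t.choose 2) := by
        refine div_le_div_of_nonneg_right ?_ (by positivity)
        rw [h𝓗, hN]
        exact htail
    _ ≤ 2 * ((t.choose 2 + 1) * (t.choose 2).choose T) *
          Real.exp (-(α ^ 2 * t / 16)) / 2 ^ (t.choose 2) := by
        refine div_le_div_of_nonneg_right (mul_le_mul_of_nonneg_left (Real.exp_le_exp.2
          (neg_le_neg ?_)) (by positivity)) (by positivity)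
        rw [hst', le_div_iff₀ (by linarith)]
        nlinarith [mul_nonneg (sq_nonneg α) (by linarith : (0 : ℝ) ≤ t),
          mul_nonneg (sq_nonneg α) (sq_nonneg (t : ℝ))]
    _ = _ := by ring

open Classical in
/-- The degree condition costs only a small proportion of the sets with the right number of
edges. -/
theorem le_expect_isQC {W S : Finset V} (hWS : W ⊆ S) (ω₀ : Sym2 V → Bool) {α : ℝ}
    (hα1 : α ≤ 1 / 2) {t T : ℕ} (hS : #S = t) (hW : #W = 0 ∨ #W = 2) (hαt : 16 ≤ α * t)
    (ht : 2 ≤ t) (hT : |(T : ℝ) - (1 / 2 + α) * (t.choose 2 : ℝ)| < 1) (hTN : T ≤ t.choose 2)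
    (ha : #(trace (pairs W) ω₀) ≤ T)
    (h0 : exactProb #(pairs S) #(pairs W) T #(trace (pairs W) ω₀) ≠ 0) :
    (1 - 16 * t * (t.choose 2 + 1) * t.choose 2 * Real.exp (-(α ^ 2 * t / 16))) *
      exactProb #(pairs S) #(pairs W) T #(trace (pairs W) ω₀) ≤
      𝔼 ω, (if IsQC α t T S (W.sym2.piecewise ω₀ ω) then (1 : ℝ) else 0) := by
  have hN : #(pairs S) = t.choose 2 := by rw [card_pairs, hS]
  -- The two diagonal elements of `W.sym2` are counted, although their bits are irrelevant.
  have hW3 : #W.sym2 ≤ 3 := by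
    rw [card_sym2]
    rcases hW with h | h <;> rw [h] <;> decide
  have hW1 : #(pairs W) ≤ 1 := by
    rw [card_pairs]
    rcases hW with h | h <;> rw [h] <;> decide
  set p := exactProb #(pairs S) #(pairs W) T #(trace (pairs W) ω₀) with hp
  have hp0 : 0 ≤ p := exactProb_nonneg _ _ _ _
  set bad : V → (Sym2 V → Bool) → ℝ := fun v ω => if #(trace (pairs S) ω) = T ∧
    3 * α / 4 * t < |(#(trace (star S v) ω) : ℝ) - (1 / 2 + α) * t| then (1 : ℝ) else 0 with hbad
  have hbad0 : ∀ v ω, 0 ≤ bad v ω := fun v ω => by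
    simp only [hbad]
    split_ifs <;> norm_num
  have hchoose : ((t.choose 2).choose T : ℝ) / 2 ^ (t.choose 2) ≤ t.choose 2 * p := by
    have := choose_div_le_mul_exactProb (N := #(pairs S)) (a := #(trace (pairs W) ω₀)) hW1
      (card_le_card (filter_subset _ _)) ha
      (by rw [hN]; exact Nat.choose_pos ht) h0
    rwa [← hp, hN] at this
  have hsplit : ∀ ω, (if #(trace (pairs S) ω) = T then (1 : ℝ) else 0) ≤
      (if IsQC α t T S ω then (1 : ℝ) else 0) + ∑ v ∈ S, bad v ω := by
    intro ω
    have hs : 0 ≤ ∑ v ∈ S, bad v ω := sum_nonneg fun v _ => hbad0 v ω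
    by_cases h1 : #(trace (pairs S) ω) = T
    · by_cases h2 : IsQC α t T S ω
      · rw [if_pos h1, if_pos h2]
        linarith
      · rw [if_pos h1, if_neg h2, zero_add]
        have h3 : ∃ v ∈ S, 3 * α / 4 * t < |(#(trace (star S v) ω) : ℝ) - (1 / 2 + α) * t| := by
          by_contra hcon
          push Not at hcon
          exact h2 ⟨h1, hcon⟩
        obtain ⟨v, hv, hv'⟩ := h3
        calc (1 : ℝ) = bad v ω := by simp only [hbad]; rw [if_pos ⟨h1, hv'⟩]
          _ ≤ _ := single_le_sum (f := fun v => bad v ω) (fun v _ => hbad0 v ω) hv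
    · rw [if_neg h1]
      refine add_nonneg ?_ hs
      split_ifs <;> norm_num
  have hb : ∀ v ∈ S, 𝔼 ω, bad v (W.sym2.piecewise ω₀ ω) ≤ 8 * (2 * ((t.choose 2 + 1 : ℝ) *
      (t.choose 2 * p)) * Real.exp (-(α ^ 2 * t / 16))) := by
    intro v hv
    have h1 := expect_degree_off_le hα1 hS ht hαt hT hTN hv
    calc _ ≤ 2 ^ #W.sym2 * 𝔼 ω, bad v ω := expect_cond_le _ _ (hbad0 v)
      _ ≤ 8 * 𝔼 ω, bad v ω := by
          refine mul_le_mul_of_nonneg_right ?_ (expect_nonneg fun ω _ => hbad0 v ω)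
          calc (2 : ℝ) ^ #W.sym2 ≤ 2 ^ 3 := pow_le_pow_right₀ (by norm_num) hW3
            _ = 8 := by norm_num
      _ ≤ 8 * (2 * ((t.choose 2 + 1 : ℝ) * ((t.choose 2).choose T / 2 ^ (t.choose 2))) *
        Real.exp (-(α ^ 2 * t / 16))) := mul_le_mul_of_nonneg_left h1 (by norm_num)
      _ ≤ _ := by gcongr
  have hmain : p ≤ 𝔼 ω, (if IsQC α t T S (W.sym2.piecewise ω₀ ω) then (1 : ℝ) else 0) +
      ∑ v ∈ S, 𝔼 ω, bad v (W.sym2.piecewise ω₀ ω) := by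
    rw [hp, ← expect_card_trace_eq hWS ω₀ ha, ← expect_sum_comm, ← expect_add_distrib]
    exact expect_le_expect fun ω _ => hsplit _
  have hsum := sum_le_card_nsmul S _ _ hb
  rw [hS, nsmul_eq_mul] at hsum
  linarith

end Probabilities

/-! ### Quasicliques through a fixed set -/

section Through

variable {V : Type*} [DecidableEq V]

/-- The vertex set `W ∪ S`, where `S` is a set of vertices outside `W`. -/
def extend (W : Finset V) (S : Finset {v // v ∉ W}) : Finset V :=
  W ∪ S.map (Function.Embedding.subtype _)

theorem mem_extend {W : Finset V} {S : Finset {v // v ∉ W}} {v : V} :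
    v ∈ extend W S ↔ v ∈ W ∨ ∃ h : v ∉ W, ⟨v, h⟩ ∈ S := by
  simp [extend]

theorem subset_extend (W : Finset V) (S : Finset {v // v ∉ W}) : W ⊆ extend W S :=
  subset_union_left

theorem card_extend (W : Finset V) (S : Finset {v // v ∉ W}) : #(extend W S) = #W + #S := by
  rw [extend, card_union_of_disjoint, card_map]
  refine disjoint_left.2 fun v hv hv' => ?_
  obtain ⟨a, -, rfl⟩ := mem_map.1 hv'
  exact a.2 hv

theorem extend_inter (W : Finset V) (S U : Finset {v // v ∉ W}) :
    extend W S ∩ extend W U = extend W (S ∩ U) := by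
  ext v
  simp only [mem_inter, mem_extend]
  by_cases hv : v ∈ W <;> simp [hv]

/-- The pairs inside `W ∪ U` that do not lie inside `W`. -/
def revealed (W : Finset V) (U : Finset {v // v ∉ W}) : Finset (Sym2 V) :=
  (extend W U).sym2 \ W.sym2

theorem revealed_mono (W : Finset V) : Monotone (revealed W) := fun _ _ h =>
  sdiff_subset_sdiff (sym2_mono (union_subset_union_right (map_subset_map.2 h))) subset_rfl

theorem revealed_inter (W : Finset V) (S U : Finset {v // v ∉ W}) :
    revealed W S ∩ revealed W U = revealed W (S ∩ U) := by
  have h : (extend W S).sym2 ∩ (extend W U).sym2 = (extend W (S ∩ U)).sym2 := by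
    rw [← extend_inter]
    ext e
    simp only [mem_inter, mem_sym2_iff]
    exact ⟨fun h v hv => ⟨h.1 v hv, h.2 v hv⟩, fun h => ⟨fun v hv => (h v hv).1,
      fun v hv => (h v hv).2⟩⟩
  rw [revealed, revealed, revealed, ← h]
  ext e
  simp only [mem_inter, mem_sdiff]
  tauto

theorem revealed_empty (W : Finset V) : revealed W ∅ = ∅ := by
  simp [revealed, extend]

theorem disjoint_revealed (W : Finset V) (B B' : Finset {v // v ∉ W}) (h : Disjoint B B') :
    Disjoint (revealed W B) (revealed W B') := by
  rw [disjoint_iff_inter_eq_empty, revealed_inter, disjoint_iff_inter_eq_empty.1 h, revealed_empty]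

theorem card_revealed_le {W : Finset V} (hW : #W = 0 ∨ #W = 2) (U : Finset {v // v ∉ W}) :
    #(revealed W U) ≤ 3 * #U ^ 2 := by
  rw [revealed, card_sdiff_of_subset (sym2_mono (subset_extend W U)), card_sym2, card_sym2,
    card_extend]
  generalize #U = j
  have h2 : ∀ m : ℕ, 2 * (m + 1).choose 2 = (m + 1) * m := by
    intro m
    rw [Nat.choose_two_right, Nat.mul_div_cancel' (Nat.even_mul_pred_self (m + 1)).two_dvd]
    simp
  rcases hW with h | h
  · rw [h]
    have := h2 j
    have h3 : j ≤ j ^ 2 := Nat.le_self_pow (by norm_num) j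
    have h4 : (0 + 1).choose 2 = 0 := by decide
    rw [h4, zero_add, Nat.sub_zero]
    nlinarith
  · rw [h]
    have := h2 (2 + j)
    have h3 : j ≤ j ^ 2 := Nat.le_self_pow (by norm_num) j
    have h4 : (2 + 1).choose 2 = 3 := by decide
    rw [h4]
    have : (2 + j + 1).choose 2 ≤ 3 * j ^ 2 + 3 := by nlinarith
    omega

open Classical in
/-- The indicator that `W ∪ S` is a quasiclique, when the pairs inside `W` have the pattern given
by `ω₀`. -/
noncomputable def qcInd (W : Finset V) (ω₀ : Sym2 V → Bool) (α : ℝ) (t T : ℕ)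
    (S : Finset {v // v ∉ W}) (ω : Sym2 V → Bool) : ℝ :=
  if IsQC α t T (extend W S) (W.sym2.piecewise ω₀ ω) then 1 else 0

variable {W : Finset V} {ω₀ : Sym2 V → Bool} {α : ℝ} {t T : ℕ}

theorem qcInd_nonneg (S : Finset {v // v ∉ W}) (ω : Sym2 V → Bool) :
    0 ≤ qcInd W ω₀ α t T S ω := by
  unfold qcInd
  split_ifs <;> norm_num

theorem dependsOn_qcInd (S : Finset {v // v ∉ W}) :
    DependsOn (qcInd W ω₀ α t T S) (revealed W S : Set (Sym2 V)) := by
  intro ω ω' h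
  have hiff : IsQC α t T (extend W S) (W.sym2.piecewise ω₀ ω) ↔
      IsQC α t T (extend W S) (W.sym2.piecewise ω₀ ω') := by
    refine IsQC_congr fun e he => ?_
    by_cases heW : e ∈ W.sym2
    · simp [heW]
    · have := h e (mem_coe.2 (mem_sdiff.2 ⟨he, heW⟩))
      simp [heW, this]
  unfold qcInd
  by_cases hq : IsQC α t T (extend W S) (W.sym2.piecewise ω₀ ω)
  · rw [if_pos hq, if_pos (hiff.1 hq)]
  · rw [if_neg hq, if_neg fun hq' => hq (hiff.2 hq')]

variable [Fintype V]

theorem expect_qcInd_le {S : Finset {v // v ∉ W}} (hS : #W + #S = t)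
    (ha : #(trace (pairs W) ω₀) ≤ T) :
    𝔼 ω, qcInd W ω₀ α t T S ω ≤
      exactProb (t.choose 2) ((#W).choose 2) T #(trace (pairs W) ω₀) := by
  have := expect_isQC_le (α := α) (t := t) (subset_extend W S) ω₀ ha
  rwa [card_pairs, card_pairs, card_extend, hS] at this

/-- The two bounds for the conditional probability of a quasiclique. When `S` and `U` share few
vertices, few bits have been revealed; when they share many, even the Chernoff bound is good
enough. -/
theorem expect_qcInd_cond_le (hW : #W = 0 ∨ #W = 2) (hα : 0 ≤ α)
    (hT : (1 / 2 + α) * (t.choose 2 : ℝ) - 1 ≤ T) (ha : #(trace (pairs W) ω₀) ≤ T) {x p : ℝ}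
    (hp : p = exactProb (t.choose 2) ((#W).choose 2) T #(trace (pairs W) ω₀)) {j₀ : ℕ}
    (hsmall : ∀ j : ℕ, j < j₀ → (2 : ℝ) ^ (3 * j ^ 2) ≤ x ^ j)
    (hlarge : ∀ j : ℕ, j₀ ≤ j → Real.exp (-(α ^ 2 * t ^ 2) + 2 * α ^ 2 * t + 4 * α +
      α * (#W + j) + 7 / 2 * α ^ 2 * (#W + j) * t) ≤ x ^ j * p)
    (S U : Finset {v // v ∉ W}) (hS : #W + #S = t) (ω : Sym2 V → Bool) :
    𝔼 ω', qcInd W ω₀ α t T S ((revealed W U).piecewise ω ω') ≤ x ^ #(S ∩ U) * p := by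
  have hp0 : 0 ≤ p := hp ▸ exactProb_nonneg _ _ _ _
  rcases lt_or_ge #(S ∩ U) j₀ with h | h
  · have h1 : ∀ ω', qcInd W ω₀ α t T S ((revealed W U).piecewise ω ω') =
        qcInd W ω₀ α t T S ((revealed W (S ∩ U)).piecewise ω ω') := by
      intro ω'
      refine dependsOn_qcInd S fun e he => ?_
      have he' : e ∈ revealed W S := mem_coe.1 he
      rw [← revealed_inter]
      by_cases heU : e ∈ revealed W U <;> simp [heU, he']
    calc _ = 𝔼 ω', qcInd W ω₀ α t T S ((revealed W (S ∩ U)).piecewise ω ω') :=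
          expect_congr rfl fun ω' _ => h1 ω'
      _ ≤ 2 ^ #(revealed W (S ∩ U)) * 𝔼 ω', qcInd W ω₀ α t T S ω' :=
          expect_cond_le _ _ fun ω' => qcInd_nonneg S ω'
      _ ≤ x ^ #(S ∩ U) * p := by
          refine mul_le_mul ?_ (hp ▸ expect_qcInd_le hS ha)
            (expect_nonneg fun ω' _ => qcInd_nonneg S ω') ?_
          · exact (pow_le_pow_right₀ (by norm_num) (card_revealed_le hW _)).trans (hsmall _ h)
          · exact le_trans (by positivity) (hsmall _ h)
  · refine le_trans ?_ (hlarge _ h)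
    have h1 : ∀ ω', W.sym2.piecewise ω₀ ((revealed W U).piecewise ω ω') =
        (extend W U).sym2.piecewise (W.sym2.piecewise ω₀ ω) ω' := by
      intro ω'
      ext e
      have hsub := sym2_mono (subset_extend W U)
      by_cases heW : e ∈ W.sym2
      · simp [heW, hsub heW]
      · have hiff : e ∈ revealed W U ↔ e ∈ (extend W U).sym2 := by simp [revealed, heW]
        by_cases heU : e ∈ (extend W U).sym2 <;> simp [heW, heU, hiff]
    have h2 := expect_isQC_cond_le hα (S := extend W S) (by rw [card_extend, hS]) hT
      (extend W U) (W.sym2.piecewise ω₀ ω)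
    rw [extend_inter, card_extend] at h2
    push_cast at h2
    refine le_trans (le_of_eq (expect_congr rfl fun ω' _ => ?_)) h2
    unfold qcInd
    rw [h1]

/-- Concentration of the number of quasicliques through `W`, in terms of the numerical parameters:
`x` bounds the gain in probability per shared vertex, `k` is the order of the moment used for the
upper tail, and `m` and `s` are the number and the size of the blocks used for the lower tail. -/
theorem expect_not_plusMinus_le (hW : #W = 0 ∨ #W = 2) (hα0 : 0 < α) (hα1 : α ≤ 1 / 2)
    (ht : 2 ≤ t) (hαt : 16 ≤ α * t) (hT : |(T : ℝ) - (1 / 2 + α) * (t.choose 2 : ℝ)| < 1)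
    (hTN : T ≤ t.choose 2) (ha : #(trace (pairs W) ω₀) ≤ T) {r : ℕ} (hr : #W + r = t) {x p : ℝ}
    (hp : p = exactProb (t.choose 2) ((#W).choose 2) T #(trace (pairs W) ω₀)) {j₀ : ℕ}
    (hx : 0 ≤ x) (hsmall : ∀ j : ℕ, j < j₀ → (2 : ℝ) ^ (3 * j ^ 2) ≤ x ^ j)
    (hlarge : p ≠ 0 → ∀ j : ℕ, j₀ ≤ j → Real.exp (-(α ^ 2 * t ^ 2) + 2 * α ^ 2 * t + 4 * α +
      α * (#W + j) + 7 / 2 * α ^ 2 * (#W + j) * t) ≤ x ^ j * p)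
    {δ : ℝ} (hδ0 : 0 < δ) (hδ1 : δ ≤ 1)
    (hη : 16 * t * (t.choose 2 + 1) * t.choose 2 * Real.exp (-(α ^ 2 * t / 16)) ≤ δ / 4)
    {n' k m s : ℕ} (hn' : Fintype.card {v // v ∉ W} = n') (hn0 : 0 < n') (hs0 : 0 < s)
    (hrs : r ≤ s) (hrn : r ≤ n') (hms : m * s ≤ n') (hk : x * r * (k * r) / n' ≤ δ / 4)
    (hs : x * r * (2 * r) / s ≤ 1 / 4) {M : ℝ} (hM : M = n'.choose r * p) :
    𝔼 ω, (if ∑ S ∈ powersetCard r univ, qcInd W ω₀ α t T S ω < M - δ * M ∨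
        M + δ * M < ∑ S ∈ powersetCard r univ, qcInd W ω₀ α t T S ω then (1 : ℝ) else 0) ≤
      Real.exp (-(k * δ / 4)) + Real.exp (-(m * δ ^ 2 / 8)) := by
  set Q : (Sym2 V → Bool) → ℝ := fun ω => ∑ S ∈ powersetCard r univ, qcInd W ω₀ α t T S ω with hQ
  have hQ0 : ∀ ω, 0 ≤ Q ω := fun ω => sum_nonneg fun S _ => qcInd_nonneg S ω
  have hp0 : 0 ≤ p := hp ▸ exactProb_nonneg _ _ _ _
  rcases hp0.eq_or_lt with hp00 | hppos
  · -- If the event is impossible, no set is a quasiclique and both sides vanish.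
    have hM0 : M = 0 := by rw [hM, ← hp00, mul_zero]
    have hQe : ∀ ω, Q ω = 0 := by
      intro ω
      refine sum_eq_zero fun S hS => ?_
      have h1 : 𝔼 ω, qcInd W ω₀ α t T S ω ≤ 0 := by
        rw [hp00, hp]
        exact expect_qcInd_le (by rw [(mem_powersetCard.1 hS).2, hr]) ha
      have h2 := (expect_eq_zero_iff_of_nonneg (s := (univ : Finset (Sym2 V → Bool)))
        fun ω _ => qcInd_nonneg (W := W) (ω₀ := ω₀) (α := α) (t := t) (T := T) S ω).1
        (le_antisymm h1 (expect_nonneg fun ω _ => qcInd_nonneg S ω))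
      exact h2 ω (mem_univ _)
    have : ∀ ω, (if Q ω < M - δ * M ∨ M + δ * M < Q ω then (1 : ℝ) else 0) = 0 := by
      intro ω
      rw [hQe, hM0]
      simp
    rw [expect_congr rfl fun ω _ => this ω, expect_const_zero]
    positivity
  have hT' : (1 / 2 + α) * (t.choose 2 : ℝ) - 1 ≤ T := by linarith [(abs_lt.1 hT).1]
  have hcond := expect_qcInd_cond_le (ω₀ := ω₀) hW hα0.le hT' ha hp hsmall (hlarge hppos.ne')
  have hcond' : ∀ S U : Finset {v // v ∉ W}, #S = r → ∀ ω,
      𝔼 ω', qcInd W ω₀ α t T S ((revealed W U).piecewise ω ω') ≤ x ^ #(S ∩ U) * p :=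
    fun S U hS => hcond S U (by rw [hS, hr])
  have hMpos : 0 < M := by
    have : 0 < (n'.choose r : ℝ) := by exact_mod_cast Nat.choose_pos hrn
    rw [hM]
    positivity
  have hcard : #(univ : Finset {v // v ∉ W}) = n' := by rw [card_univ, hn']
  -- The moment exceeds `M ^ k` by at most `exp (k δ / 4)`, while `(1 + δ) ^ k` is at least
  -- `exp (k δ / 2)`.
  have upper : 𝔼 ω, (if (1 + δ) * M ≤ Q ω then (1 : ℝ) else 0) ≤ Real.exp (-(k * δ / 4)) := by
    have h1 := expect_sum_powersetCard_pow_le (revealed_mono W) (fun S ω => qcInd_nonneg S ω)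
      (fun S => dependsOn_qcInd S) hx hp0 hcond' (B := univ) (by rw [hcard]; exact hrn)
      (by rw [hcard]; exact hn0) k
    rw [hcard, ← hM] at h1
    refine (expect_indicator_le_div_pow hQ0 (by positivity) h1).trans ?_
    rw [show -(k * δ / 4) = k * (-(δ / 4)) by ring, Real.exp_nat_mul]
    refine pow_le_pow_left₀ (by positivity) ?_ k
    rw [div_le_iff₀ (by positivity)]
    have h2 : 1 ≤ (1 + δ) * Real.exp (-(δ / 2)) := by
      have := Real.one_sub_le_exp_neg (δ / 2)
      nlinarith
    calc M * Real.exp (x * r * (k * r) / n') ≤ M * Real.exp (δ / 4) := by gcongr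
      _ ≤ M * Real.exp (δ / 4) * ((1 + δ) * Real.exp (-(δ / 2))) :=
          le_mul_of_one_le_right (by positivity) h2
      _ = (Real.exp (δ / 4) * Real.exp (-(δ / 2))) * ((1 + δ) * M) := by ring
      _ = _ := by
          rw [← Real.exp_add]
          congr 2
          ring
  have lower : 𝔼 ω, (if Q ω ≤ (1 - δ) * M then (1 : ℝ) else 0) ≤
      Real.exp (-(m * δ ^ 2 / 8)) := by
    have hsr : 0 < (s.choose r : ℝ) := by exact_mod_cast Nat.choose_pos hrs
    have h1 : ∀ B : Finset {v // v ∉ W}, #B = s → (1 - δ / 4) * (s.choose r * p) ≤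
        𝔼 ω, ∑ S ∈ powersetCard r B, qcInd W ω₀ α t T S ω := by
      intro B hB
      rw [expect_sum_comm, ← hB, ← card_powersetCard]
      have : ∀ S ∈ powersetCard r B, (1 - δ / 4) * p ≤ 𝔼 ω, qcInd W ω₀ α t T S ω := by
        intro S hS
        have hc : #(extend W S) = t := by rw [card_extend, (mem_powersetCard.1 hS).2, hr]
        have h0 : exactProb #(pairs (extend W S)) #(pairs W) T #(trace (pairs W) ω₀) = p := by
          rw [hp, card_pairs, card_pairs, hc]
        have := le_expect_isQC (subset_extend W S) ω₀ hα1 hc hW hαt ht hT hTN ha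
          (by rw [h0]; exact hppos.ne')
        rw [h0] at this
        refine le_trans ?_ this
        exact mul_le_mul_of_nonneg_right (by linarith) hp0
      have := card_nsmul_le_sum _ _ _ this
      rw [nsmul_eq_mul] at this
      linarith
    have h2 : ∀ B : Finset {v // v ∉ W}, #B = s →
        𝔼 ω, (∑ S ∈ powersetCard r B, qcInd W ω₀ α t T S ω) ^ 2 ≤ 2 * (s.choose r * p) ^ 2 := by
      intro B hB
      have h1 := expect_sum_powersetCard_pow_le (revealed_mono W) (fun S ω => qcInd_nonneg S ω)
        (fun S => dependsOn_qcInd S) hx hp0 hcond' (B := B) (by rw [hB]; exact hrs)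
        (by rw [hB]; exact hs0) 2
      rw [hB] at h1
      push_cast at h1
      refine h1.trans ?_
      rw [mul_pow, mul_comm]
      refine mul_le_mul_of_nonneg_right ?_ (by positivity)
      rw [← Real.exp_nat_mul]
      calc Real.exp ((2 : ℕ) * (x * r * (2 * r) / s)) ≤ Real.exp (1 / 2) := by
            refine Real.exp_le_exp.2 ?_
            push_cast
            linarith
        _ ≤ 2 := by
            have := Real.one_sub_le_exp_neg (1 / 2)
            rw [Real.exp_neg] at this
            have h3 := Real.exp_pos (1 / 2)
            rw [show (1 : ℝ) - 1 / 2 = 2⁻¹ by norm_num] at this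
            exact (inv_le_inv₀ (by norm_num) h3).1 this
    -- For `η = θ = δ / 4` the exponent `θ * (δ - η) - θ ^ 2` is `δ ^ 2 / 8`.
    have h3 := expect_lower_tail_le (disjoint_revealed W) (revealed_mono W)
      (fun S ω => qcInd_nonneg S ω) (fun S => dependsOn_qcInd S) (r := r) (m := m) (s := s)
      (by rw [hn']; exact hms) (by rw [hn']; exact hrn) (P := p) (η := δ / 4) (δ := δ)
      (θ := δ / 4) (by positivity) (by positivity) h1 h2
    rw [hn', ← hM] at h3
    refine h3.trans (le_of_eq ?_)
    congr 1
    ring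
  calc _ ≤ 𝔼 ω, ((if (1 + δ) * M ≤ Q ω then (1 : ℝ) else 0) +
        if Q ω ≤ (1 - δ) * M then (1 : ℝ) else 0) := by
        refine expect_le_expect fun ω _ => ?_
        have a1 : (0 : ℝ) ≤ if (1 + δ) * M ≤ Q ω then (1 : ℝ) else 0 := by
          split_ifs <;> norm_num
        have a2 : (0 : ℝ) ≤ if Q ω ≤ (1 - δ) * M then (1 : ℝ) else 0 := by
          split_ifs <;> norm_num
        by_cases h : Q ω < M - δ * M ∨ M + δ * M < Q ω
        · rw [if_pos h]
          rcases h with h | h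
          · rw [if_pos (show Q ω ≤ (1 - δ) * M by linarith)]
            linarith
          · rw [if_pos (show (1 + δ) * M ≤ Q ω by linarith)]
            linarith
        · rw [if_neg h]
          exact add_nonneg a1 a2
    _ ≤ _ := by
        rw [expect_add_distrib]
        exact add_le_add upper lower

end Through

/-! ### Estimates for the parameters -/

theorem c_bounds : 0.014 ≤ c ∧ c ≤ 0.015 := by
  have h1 := Real.log_two_gt_d9
  have h2 := Real.log_two_lt_d9
  have h0 : (0 : ℝ) < 100 * Real.log 2 := by linarith
  unfold c
  constructor
  · rw [le_div_iff₀ h0]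
    linarith
  · rw [div_le_iff₀ h0]
    linarith

theorem A_bounds : 0 ≤ A ∧ A ≤ 0.000002 := by
  obtain ⟨h1, h2⟩ := c_bounds
  have : A = c / 10000 := by
    unfold A
    norm_num
    ring
  rw [this]
  constructor <;> linarith

/-- The size of `t`, where `L` stands for `log n`. -/
theorem size_bounds {L α : ℝ} {t : ℕ} (hL : 1000 ≤ L) (hα0 : 0 < α) (hα1 : α ≤ 1 / 2)
    (hαL : 1 / L ≤ α ^ 2) (ht : |(t : ℝ) - c * α ^ (-2 : ℤ) * L| < 1) :
    0.013 * L ≤ α ^ 2 * t ∧ α ^ 2 * t ≤ 0.016 * L ∧ (t : ℝ) ≤ L ^ 2 ∧ 16 ≤ α * t := by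
  obtain ⟨hc1, hc2⟩ := c_bounds
  have hα2 : 0 < α ^ 2 := by positivity
  have hα4 : α ^ 2 ≤ 1 / 4 := by nlinarith
  have e : α ^ 2 * ((t : ℝ) - c * α ^ (-2 : ℤ) * L) = α ^ 2 * t - c * L := by
    rw [zpow_neg, zpow_ofNat]
    field_simp
  obtain ⟨h1, h2⟩ := abs_lt.1 ht
  have h3 := mul_lt_mul_of_pos_left h1 hα2
  have h4 := mul_lt_mul_of_pos_left h2 hα2
  rw [e] at h3 h4
  have h5 : 0.013 * L ≤ α ^ 2 * t := by nlinarith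
  have h6 : α ^ 2 * t ≤ 0.016 * L := by nlinarith
  refine ⟨h5, h6, ?_, ?_⟩
  · have hL0 : 0 < L := by linarith
    have h7 : 1 / L * t ≤ 0.016 * L :=
      (mul_le_mul_of_nonneg_right hαL (Nat.cast_nonneg t)).trans h6
    rw [one_div, inv_mul_le_iff₀ hL0] at h7
    nlinarith
  · have : 0 ≤ α * t := by positivity
    nlinarith

/-- A lower bound for the probability of having the right number of edges. -/
theorem exp_le_mul_exactProb {α : ℝ} {t T w a : ℕ} (hα0 : 0 < α) (hα1 : α ≤ 1 / 2)
    (h4 : 16 ≤ α * t) (ht : 2 ≤ t)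
    (hT : |(T : ℝ) - (1 / 2 + α) * (t.choose 2 : ℝ)| < 1) (hTN : T ≤ t.choose 2)
    (hw : w ≤ 1) (ha : a ≤ w) (haT : a ≤ T) (hp : exactProb (t.choose 2) w T a ≠ 0) :
    Real.exp (-(α ^ 2 * t ^ 2 + 4 + 43 * (α ^ 2 * t) ^ 2)) ≤
      t ^ 4 * exactProb (t.choose 2) w T a := by
  have hN1 : 1 ≤ t.choose 2 := Nat.choose_pos ht
  have hp0 := exactProb_nonneg (t.choose 2) w T a
  have hq := choose_div_le_mul_exactProb hw ha haT hN1 hp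
  have hexp := exp_le_succ_mul_choose_div hN1 hTN
  have hNr : (t.choose 2 : ℝ) = t * (t - 1) / 2 := Nat.cast_choose_two ℝ t
  have hN1' : (1 : ℝ) ≤ (t.choose 2 : ℝ) := by exact_mod_cast hN1
  generalize exactProb (t.choose 2) w T a = p at *
  generalize ((t.choose 2).choose T : ℝ) / 2 ^ (t.choose 2) = q at *
  generalize (t.choose 2 : ℝ) = N at *
  have hN0 : 0 < N := by linarith
  have ht2 : (2 : ℝ) ≤ t := by exact_mod_cast ht
  have htt : 2 * (t : ℝ) ≤ t ^ 2 := by rw [pow_two]; gcongr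
  have hNt : N ≤ t ^ 2 / 2 := by rw [hNr]; linarith [pow_two (t : ℝ)]
  set β : ℝ := T / N - 1 / 2 with hβ
  have hβα : |β - α| ≤ 1 / N := by
    have e : β - α = (T - (1 / 2 + α) * N) / N := by
      rw [hβ]
      field_simp
      ring
    rw [e, abs_div, abs_of_pos hN0]
    gcongr
  have hNα : 1 / N ≤ α := by
    have h5 : (t : ℝ) ≤ 2 * N := by rw [hNr]; linarith [pow_two (t : ℝ)]
    have h6 : α * t ≤ α * (2 * N) := by gcongr
    rw [div_le_iff₀ hN0]
    linarith
  obtain ⟨b1, b2⟩ := abs_le.1 hβα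
  have hβ0 : 0 ≤ β := by linarith
  have hβ2 : N * β ^ 2 ≤ α ^ 2 * t ^ 2 / 2 + 2 := by
    have h5 : N * β ^ 2 ≤ N * (α + 1 / N) ^ 2 := by
      gcongr
      linarith
    have h6 : N * (α + 1 / N) ^ 2 = N * α ^ 2 + 2 * α + 1 / N := by
      field_simp
      ring
    have h7 : 1 / N ≤ 1 := (div_le_one hN0).2 hN1'
    have h8 : N * α ^ 2 ≤ t ^ 2 / 2 * α ^ 2 := by gcongr
    linarith
  have hβ4 : N * β ^ 4 ≤ 8 * (α ^ 2 * t) ^ 2 := by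
    have h5 : β ^ 4 ≤ (2 * α) ^ 4 := pow_le_pow_left₀ hβ0 (by linarith) 4
    calc N * β ^ 4 ≤ (t ^ 2 / 2) * (2 * α) ^ 4 := by gcongr
      _ = _ := by ring
  have hN2 : N + 1 ≤ t ^ 2 := by linarith
  calc Real.exp (-(α ^ 2 * t ^ 2 + 4 + 43 * (α ^ 2 * t) ^ 2))
      ≤ Real.exp (-(N * (2 * β ^ 2 + 16 / 3 * β ^ 4))) := by
        rw [Real.exp_le_exp, neg_le_neg_iff]
        have := sq_nonneg (α ^ 2 * t)
        linarith
    _ ≤ (N + 1) * q := hexp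
    _ ≤ (N + 1) * (N * p) := by gcongr
    _ ≤ t ^ 2 * (t ^ 2 * p) := by
        gcongr
        linarith
    _ = _ := by ring

/-- The gain `e ^ (0.3 L)` per shared vertex makes up for everything when at least `L / 10`
vertices are shared. -/
theorem large_overlap_bound {L α : ℝ} {t T w a j : ℕ} (hL : 1000 ≤ L)
    (hG : 64 * L ^ 10 ≤ Real.exp (0.0007 * L)) (hα0 : 0 < α) (hα1 : α ≤ 1 / 2)
    (h2 : α ^ 2 * t ≤ 0.016 * L) (h3 : (t : ℝ) ≤ L ^ 2) (h4 : 16 ≤ α * t) (ht : 2 ≤ t)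
    (hT : |(T : ℝ) - (1 / 2 + α) * (t.choose 2 : ℝ)| < 1) (hTN : T ≤ t.choose 2)
    (hw : w = 0 ∨ w = 2) (ha : a ≤ w.choose 2) (haT : a ≤ T)
    (hp : exactProb (t.choose 2) (w.choose 2) T a ≠ 0) (hj : L / 10 ≤ j) :
    Real.exp (-(α ^ 2 * t ^ 2) + 2 * α ^ 2 * t + 4 * α + α * (w + j) +
      7 / 2 * α ^ 2 * (w + j) * t) ≤
      Real.exp (0.3 * L) ^ j * exactProb (t.choose 2) (w.choose 2) T a := by
  have hw1 : w.choose 2 ≤ 1 := by rcases hw with h | h <;> rw [h] <;> decide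
  have hw2 : (w : ℝ) ≤ 2 := by rcases hw with h | h <;> rw [h] <;> norm_num
  have hexp := exp_le_mul_exactProb hα0 hα1 h4 ht hT hTN hw1 ha haT hp
  have hp0 := exactProb_nonneg (t.choose 2) (w.choose 2) T a
  generalize exactProb (t.choose 2) (w.choose 2) T a = p at *
  have ht4 : (t : ℝ) ^ 4 ≤ Real.exp (0.0007 * L) := by
    have h7 : (L ^ 2) ^ 4 ≤ 64 * L ^ 10 := by
      have h8 : (L ^ 2) ^ 4 ≤ L ^ 10 := by
        rw [← pow_mul]
        exact pow_le_pow_right₀ (by linarith) (by norm_num)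
      have : 0 ≤ L ^ 10 := by positivity
      linarith
    calc (t : ℝ) ^ 4 ≤ (L ^ 2) ^ 4 := by gcongr
      _ ≤ _ := h7.trans hG
  have key : Real.exp (-(α ^ 2 * t ^ 2 + 4 + 43 * (α ^ 2 * t) ^ 2) - 0.0007 * L) ≤ p := by
    rw [Real.exp_sub, div_le_iff₀ (Real.exp_pos _), mul_comm p]
    exact hexp.trans (mul_le_mul_of_nonneg_right ht4 hp0)
  refine le_trans ?_ (mul_le_mul_of_nonneg_left key (by positivity))
  rw [← Real.exp_nat_mul, ← Real.exp_add, Real.exp_le_exp]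
  have hj0 : (0 : ℝ) ≤ j := Nat.cast_nonneg j
  have hL2 : (α ^ 2 * t) ^ 2 ≤ (0.016 * L) ^ 2 := by gcongr
  have m1 : α * (w + j) ≤ 1 / 2 * (2 + j) := by gcongr
  have m2 : 7 / 2 * α ^ 2 * (w + j) * t ≤ 7 / 2 * (0.016 * L) * (2 + j) := by
    calc 7 / 2 * α ^ 2 * (w + j) * t = 7 / 2 * (α ^ 2 * t) * (w + j) := by ring
      _ ≤ _ := by gcongr
  have m3 : L * L ≤ L * (10 * j) := by
    refine mul_le_mul_of_nonneg_left ?_ (by linarith)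
    linarith
  have m4 : 1000 * (j : ℝ) ≤ L * j := by gcongr
  linarith

theorem small_overlap_bound {L : ℝ} {j : ℕ} (hj : (j : ℝ) ≤ L / 10) :
    (2 : ℝ) ^ (3 * j ^ 2) ≤ Real.exp (0.3 * L) ^ j := by
  have h2 := Real.log_two_lt_d9
  have hj0 : (0 : ℝ) ≤ j := Nat.cast_nonneg j
  rw [← Real.exp_nat_mul, ← Real.rpow_natCast 2, Real.rpow_def_of_pos two_pos, Real.exp_le_exp]
  push_cast
  have h3 : Real.log 2 * (3 * (j : ℝ) ^ 2) ≤ 0.7 * (3 * (j : ℝ) ^ 2) := by gcongr; linarith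
  nlinarith

theorem degree_loss_bound {L α δ : ℝ} {t : ℕ} (hL : 1000 ≤ L)
    (hG : 64 * L ^ 10 ≤ Real.exp (0.0007 * L)) (h1 : 0.013 * L ≤ α ^ 2 * t)
    (h3 : (t : ℝ) ≤ L ^ 2) (ht : 2 ≤ t) (hδ : Real.exp (-(0.0001 * L)) ≤ δ) :
    16 * t * (t.choose 2 + 1) * t.choose 2 * Real.exp (-(α ^ 2 * t / 16)) ≤ δ / 4 := by
  have hNr : (t.choose 2 : ℝ) = t * (t - 1) / 2 := Nat.cast_choose_two ℝ t
  have ht2 : (2 : ℝ) ≤ t := by exact_mod_cast ht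
  have a1 : (t.choose 2 : ℝ) + 1 ≤ t ^ 2 := by rw [hNr]; nlinarith
  have a2 : (t.choose 2 : ℝ) ≤ t ^ 2 := by linarith
  have a3 : Real.exp (-(α ^ 2 * t / 16)) ≤ Real.exp (-(0.0007 * L) + -(0.0001 * L)) :=
    Real.exp_le_exp.2 (by linarith)
  have a4 : 16 * t * (t.choose 2 + 1 : ℝ) * t.choose 2 ≤ Real.exp (0.0007 * L) / 4 := by
    calc 16 * t * (t.choose 2 + 1 : ℝ) * t.choose 2 ≤ 16 * t * t ^ 2 * t ^ 2 := by gcongr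
      _ = 16 * (t : ℝ) ^ 5 := by ring
      _ ≤ 16 * (L ^ 2) ^ 5 := by gcongr
      _ = (64 * L ^ 10) / 4 := by ring
      _ ≤ _ := by gcongr
  calc _ ≤ Real.exp (0.0007 * L) / 4 * Real.exp (-(0.0007 * L) + -(0.0001 * L)) := by gcongr
    _ = Real.exp (-(0.0001 * L)) / 4 := by
        rw [div_mul_eq_mul_div, ← Real.exp_add]
        congr 2
        ring
    _ ≤ _ := by gcongr

/-- The estimates for the number `m` of blocks, which is also the order of the moment, and for the
size `s` of the blocks. -/
theorem block_bounds {n n' m s r w : ℕ} {L δ : ℝ} (hn : (n : ℝ) = Real.exp L) (hL : 1000 ≤ L)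
    (hG : 64 * L ^ 10 ≤ Real.exp (0.0007 * L)) (hw : w ≤ 2) (hn' : n' + w = n)
    (hm : m = ⌊Real.exp (L / 4)⌋₊) (hs : s = n' / m) (hr : (r : ℝ) ≤ L ^ 2)
    (hδ : Real.exp (-(0.0001 * L)) ≤ δ) (hδ1 : δ ≤ 1) :
    0 < n' ∧ 0 < s ∧ r ≤ s ∧ r ≤ n' ∧ m * s ≤ n' ∧
      Real.exp (0.3 * L) * r * (m * r) / n' ≤ δ / 4 ∧
      Real.exp (0.3 * L) * r * (2 * r) / s ≤ 1 / 4 ∧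
      Real.exp (0.22 * L) ≤ m * δ / 4 ∧ Real.exp (0.22 * L) ≤ m * δ ^ 2 / 8 := by
  have hL10 : 1 ≤ L ^ 10 := one_le_pow₀ (by linarith)
  have h64 : 64 ≤ Real.exp (0.0007 * L) := by linarith
  have hbig : ∀ z : ℝ, 0.0007 ≤ z → 64 ≤ Real.exp (z * L) := fun z hz =>
    h64.trans (Real.exp_le_exp.2 (by nlinarith))
  have hL4 : L ^ 4 * 64 ≤ Real.exp (0.0007 * L) := by
    have : L ^ 4 ≤ L ^ 10 := pow_le_pow_right₀ (by linarith) (by norm_num)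
    linarith
  have hL2 : L ^ 2 ≤ Real.exp (0.0007 * L) := by
    have : L ^ 2 ≤ L ^ 10 := pow_le_pow_right₀ (by linarith) (by norm_num)
    linarith
  have split : ∀ u v : ℝ, Real.exp ((u + v) * L) = Real.exp (u * L) * Real.exp (v * L) := by
    intro u v
    rw [add_mul, Real.exp_add]
  have hmle : (m : ℝ) ≤ Real.exp (0.25 * L) := by
    rw [hm, show 0.25 * L = L / 4 by ring]
    exact Nat.floor_le (Real.exp_pos _).le
  have hmge : Real.exp (0.24 * L) ≤ m := by
    have h1 : Real.exp (0.25 * L) < m + 1 := by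
      rw [hm, show 0.25 * L = L / 4 by ring]
      exact Nat.lt_floor_add_one _
    have h2 := split 0.24 0.01
    rw [show (0.24 : ℝ) + 0.01 = 0.25 by norm_num] at h2
    nlinarith [hbig 0.01 (by norm_num), hbig 0.24 (by norm_num)]
  have hm0 : 0 < m := by
    have : (0 : ℝ) < m := (Real.exp_pos _).trans_le hmge
    exact_mod_cast this
  have hm0' : (0 : ℝ) < m := by exact_mod_cast hm0
  have hn'ge : Real.exp L / 2 ≤ n' := by
    have h1 : (n' : ℝ) + w = Real.exp L := by
      rw [← hn]
      exact_mod_cast hn'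
    have h2 : (w : ℝ) ≤ 2 := by exact_mod_cast hw
    have h3 := hbig 1 (by norm_num)
    rw [one_mul] at h3
    linarith
  have hn'0 : (0 : ℝ) < n' := lt_of_lt_of_le (by positivity) hn'ge
  have hsge : Real.exp (0.7 * L) ≤ s := by
    have h1 : (n' : ℝ) < m * (s + 1) := by
      rw [hs]
      exact_mod_cast Nat.lt_mul_div_succ n' hm0
    have h2 : Real.exp L / 2 < Real.exp (0.25 * L) * (s + 1) :=
      (hn'ge.trans_lt h1).trans_le (by gcongr)
    have h3 := split 0.25 0.75
    rw [show (0.25 : ℝ) + 0.75 = 1 by norm_num, one_mul] at h3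
    have h4 : Real.exp (0.75 * L) / 2 < s + 1 := by
      refine lt_of_mul_lt_mul_left ?_ (Real.exp_pos (0.25 * L)).le
      linarith
    have h5 := split 0.7 0.05
    rw [show (0.7 : ℝ) + 0.05 = 0.75 by norm_num] at h5
    nlinarith [hbig 0.05 (by norm_num), hbig 0.7 (by norm_num)]
  have hs0' : (0 : ℝ) < s := (Real.exp_pos _).trans_le hsge
  have hrs : r ≤ s := by
    have : (r : ℝ) ≤ s := by
      refine hr.trans (hL2.trans (le_trans (Real.exp_le_exp.2 ?_) hsge))
      nlinarith
    exact_mod_cast this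
  have hms : m * s ≤ n' := by
    rw [hs]
    exact Nat.mul_div_le n' m
  have hsn : s ≤ n' := (Nat.le_mul_of_pos_left s hm0).trans hms
  have hr0 : (0 : ℝ) ≤ r := Nat.cast_nonneg r
  have hrr : (r : ℝ) * r ≤ L ^ 4 := by
    calc (r : ℝ) * r ≤ L ^ 2 * L ^ 2 := by gcongr
      _ = L ^ 4 := by ring
  have hδ0 : 0 < δ := (Real.exp_pos _).trans_le hδ
  have hd2 : Real.exp (-(0.0002 * L)) ≤ δ ^ 2 := by
    rw [show -(0.0002 * L) = (2 : ℕ) * -(0.0001 * L) by push_cast; ring, Real.exp_nat_mul]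
    gcongr
  have hlast : Real.exp (0.22 * L) ≤ m * δ ^ 2 / 8 := by
    have h1 : Real.exp (0.24 * L) * Real.exp (-(0.0002 * L)) ≤ m * δ ^ 2 := by gcongr
    rw [← Real.exp_add, show 0.24 * L + -(0.0002 * L) = (0.22 + 0.0198) * L by ring, split] at h1
    nlinarith [hbig 0.0198 (by norm_num), Real.exp_pos (0.22 * L)]
  refine ⟨by exact_mod_cast hn'0, by exact_mod_cast hs0', hrs, hrs.trans hsn, hms, ?_, ?_, ?_,
    hlast⟩
  · rw [div_le_iff₀ hn'0]
    have h1 : Real.exp (0.3 * L) * r * (m * r) ≤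
        Real.exp (0.3 * L) * Real.exp (0.25 * L) * Real.exp (0.0007 * L) / 64 := by
      calc Real.exp (0.3 * L) * r * (m * r) = Real.exp (0.3 * L) * m * (r * r) := by ring
        _ ≤ Real.exp (0.3 * L) * Real.exp (0.25 * L) * (Real.exp (0.0007 * L) / 64) := by
            gcongr
            linarith
        _ = _ := by ring
    have h2 : Real.exp (0.3 * L) * Real.exp (0.25 * L) * Real.exp (0.0007 * L) ≤
        Real.exp (-(0.0001 * L)) * Real.exp L := by
      rw [← Real.exp_add, ← Real.exp_add, ← Real.exp_add, Real.exp_le_exp]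
      linarith
    have h3 : Real.exp (-(0.0001 * L)) * (Real.exp L / 2) ≤ δ * n' := by gcongr
    have h4 : 0 < Real.exp (-(0.0001 * L)) * Real.exp L := by positivity
    linarith
  · rw [div_le_iff₀ hs0']
    have h1 : Real.exp (0.3 * L) * r * (2 * r) ≤
        Real.exp (0.3 * L) * Real.exp (0.0007 * L) / 32 := by
      calc Real.exp (0.3 * L) * r * (2 * r) = Real.exp (0.3 * L) * (2 * (r * r)) := by ring
        _ ≤ Real.exp (0.3 * L) * (2 * (Real.exp (0.0007 * L) / 64)) := by
            gcongr
            linarith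
        _ = _ := by ring
    have h2 : Real.exp (0.3 * L) * Real.exp (0.0007 * L) ≤ Real.exp (0.7 * L) := by
      rw [← Real.exp_add, Real.exp_le_exp]
      linarith
    linarith
  · refine hlast.trans ?_
    have : m * δ ^ 2 ≤ m * δ := by
      refine mul_le_mul_of_nonneg_left ?_ hm0'.le
      nlinarith
    have : 0 ≤ m * δ := by positivity
    linarith

theorem union_bound_numeric {n : ℕ} {L : ℝ} (hn : (n : ℝ) = Real.exp L) (hL : 1000 ≤ L)
    (hG : 64 * L ^ 10 ≤ Real.exp (0.0007 * L)) :
    (2 * (n : ℝ) ^ 2 + 1) * (2 * Real.exp (-Real.exp (0.22 * L))) ≤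
      2 * Real.exp (-((n : ℝ) ^ (1 / 5 : ℝ))) := by
  have hL10 : L ≤ L ^ 10 := by
    calc L = L ^ 1 := (pow_one L).symm
      _ ≤ L ^ 10 := pow_le_pow_right₀ (by linarith) (by norm_num)
  have h1 : 64 * L ≤ Real.exp (0.02 * L) :=
    le_trans (by linarith) (hG.trans (Real.exp_le_exp.2 (by linarith)))
  have e1 : (n : ℝ) ^ (1 / 5 : ℝ) = Real.exp (0.2 * L) := by
    rw [hn, ← Real.exp_mul]
    congr 1
    ring
  have e2 : Real.exp (0.22 * L) = Real.exp (0.2 * L) * Real.exp (0.02 * L) := by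
    rw [← Real.exp_add]
    congr 1
    ring
  have h2 : 1 ≤ Real.exp (0.2 * L) := Real.one_le_exp (by linarith)
  have h3 : 3 * L + Real.exp (0.2 * L) ≤ Real.exp (0.22 * L) := by
    rw [e2]
    nlinarith
  have h4 : 2 * (n : ℝ) ^ 2 + 1 ≤ Real.exp (3 * L) := by
    have h5 : Real.exp (3 * L) = Real.exp L ^ 2 * Real.exp L := by
      rw [← pow_succ, ← Real.exp_nat_mul]
      norm_num
    have h6 : 1000 ≤ Real.exp L := by linarith [Real.add_one_le_exp L]
    rw [h5, hn]
    nlinarith [sq_nonneg (Real.exp L), one_le_pow₀ (n := 2) (show (1 : ℝ) ≤ Real.exp L by linarith)]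
  rw [e1]
  calc (2 * (n : ℝ) ^ 2 + 1) * (2 * Real.exp (-Real.exp (0.22 * L)))
      ≤ Real.exp (3 * L) * (2 * Real.exp (-Real.exp (0.22 * L))) := by gcongr
    _ = 2 * Real.exp (3 * L + -Real.exp (0.22 * L)) := by rw [Real.exp_add]; ring
    _ ≤ _ := by
        gcongr
        linarith

theorem eventually_pow_le_exp : ∀ᶠ L : ℝ in Filter.atTop,
    64 * L ^ 10 ≤ Real.exp (0.0007 * L) := by
  have h := tendsto_exp_mul_div_rpow_atTop 10 0.0007 (by norm_num)
  filter_upwards [h.eventually_ge_atTop 64, Filter.eventually_gt_atTop 0] with L hL hL0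
  rw [le_div_iff₀ (by positivity)] at hL
  exact_mod_cast hL

/-! ### From random bits to the binomial random graph -/

section Graphs

variable {V : Type*}

/-- The graph whose edges are the pairs of distinct vertices with bit `true`; the bits of the diagonal
elements of `Sym2 V` are ignored. -/
def graphOf (ω : Sym2 V → Bool) : SimpleGraph V := SimpleGraph.fromEdgeSet {e | ω e = true}

theorem graphOf_adj {ω : Sym2 V → Bool} {u v : V} :
    (graphOf ω).Adj u v ↔ ω s(u, v) = true ∧ u ≠ v := by
  simp [graphOf]

variable [DecidableEq V]

theorem mem_trace_pairs {S : Finset V} {ω : Sym2 V → Bool} {u v : V} :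
    s(u, v) ∈ trace (pairs S) ω ↔ (u ∈ S ∧ v ∈ S) ∧ (graphOf ω).Adj u v := by
  rw [trace, mem_filter, mk_mem_pairs, graphOf_adj]
  tauto

theorem ncard_edgeSet_induce_graphOf (S : Finset V) (ω : Sym2 V → Bool) :
    ((graphOf ω).induce (S : Set V)).edgeSet.ncard = #(trace (pairs S) ω) := by
  rw [← Set.ncard_image_of_injective _ (Sym2.map.injective
    (Subtype.val_injective (p := fun v => v ∈ (S : Set V)))), ← Set.ncard_coe_finset]
  congr 1
  ext e
  induction e with
  | _ a b =>
    rw [mem_coe, mem_trace_pairs]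
    constructor
    · rintro ⟨e', he', h⟩
      induction e' with
      | _ x y =>
        have hadj : (graphOf ω).Adj x y := he'
        rw [Sym2.map_mk] at h
        rcases Sym2.eq_iff.1 h with ⟨h1, h2⟩ | ⟨h1, h2⟩
        · rw [← h1, ← h2]
          exact ⟨⟨x.2, y.2⟩, hadj⟩
        · rw [← h1, ← h2]
          exact ⟨⟨y.2, x.2⟩, hadj.symm⟩
    · rintro ⟨⟨ha, hb⟩, hab⟩
      exact ⟨s(⟨a, ha⟩, ⟨b, hb⟩), hab, rfl⟩

theorem ncard_neighborSet_induce_graphOf (S : Finset V) (ω : Sym2 V → Bool)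
    (v : (S : Set V)) :
    (((graphOf ω).induce (S : Set V)).neighborSet v).ncard = #(trace (star S v) ω) := by
  have hinj : Function.Injective fun u : (S : Set V) => s((v : V), (u : V)) := fun a b h =>
    Subtype.ext (Sym2.congr_right.1 h)
  rw [← Set.ncard_image_of_injective _ hinj, ← Set.ncard_coe_finset]
  congr 1
  ext e
  rw [mem_coe, star, trace_star, mem_filter]
  constructor
  · rintro ⟨u, hu, rfl⟩
    have hadj : (graphOf ω).Adj v u := hu
    exact ⟨mem_trace_pairs.2 ⟨⟨v.2, u.2⟩, hadj⟩, Sym2.mem_mk_left _ _⟩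
  · rintro ⟨he, hv⟩
    obtain ⟨u, rfl⟩ := Sym2.mem_iff_exists.1 hv
    obtain ⟨⟨-, hu⟩, hadj⟩ := mem_trace_pairs.1 he
    exact ⟨⟨u, hu⟩, hadj, rfl⟩

theorem plusMinus_iff {x a b : ℝ} : PlusMinus x a b ↔ |x - a| ≤ b := by
  rw [PlusMinus, abs_le]
  constructor <;> rintro ⟨h1, h2⟩ <;> constructor <;> linarith

theorem isQuasiclique_induce_iff {S : Finset V} {t : ℕ} (hS : #S = t) {α : ℝ} {T : ℕ}
    {ω : Sym2 V → Bool} :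
    IsQuasiclique α T ((graphOf ω).induce (S : Set V)) ↔ IsQC α t T S ω := by
  have hc : Nat.card (S : Set V) = t := by
    rw [Nat.card_coe_set_eq, Set.ncard_coe_finset, hS]
  unfold IsQuasiclique IsQC
  rw [ncard_edgeSet_induce_graphOf]
  refine and_congr_right fun _ => ?_
  constructor
  · intro h v hv
    have := h ⟨v, hv⟩
    rwa [ncard_neighborSet_induce_graphOf, hc, plusMinus_iff] at this
  · intro h v
    rw [ncard_neighborSet_induce_graphOf, hc, plusMinus_iff]
    exact h v v.2

theorem graphOf_piecewise_const {u v : V} {b : Bool} {ω : Sym2 V → Bool} (h : ω s(u, v) = b) :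
    graphOf (({u, v} : Finset V).sym2.piecewise (fun _ => b) ω) = graphOf ω := by
  ext x y
  rw [graphOf_adj, graphOf_adj]
  refine and_congr_left fun hxy => ?_
  by_cases he : s(x, y) ∈ ({u, v} : Finset V).sym2
  · have : s(x, y) = s(u, v) := by
      rw [mk_mem_sym2_iff, mem_insert, mem_insert, mem_singleton, mem_singleton] at he
      obtain ⟨rfl | rfl, rfl | rfl⟩ := he
      · exact absurd rfl hxy
      · rfl
      · exact Sym2.eq_swap
      · exact absurd rfl hxy
    rw [piecewise_eq_of_mem _ _ _ he, this, h]
  · rw [piecewise_eq_of_notMem _ _ _ he]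

variable [Fintype V]

omit [DecidableEq V] in
theorem mem_quasicliquesThrough {G : SimpleGraph V} {α : ℝ} {t T : ℕ} {W S : Finset V} :
    S ∈ quasicliquesThrough G α t T W ↔
      (#S = t ∧ IsQuasiclique α T (G.induce (S : Set V))) ∧ W ⊆ S := by
  simp [quasicliquesThrough, quasicliques]

theorem card_quasicliquesThrough {W : Finset V} {r t T : ℕ} (hr : #W + r = t) (α : ℝ)
    (ω₀ ω : Sym2 V → Bool) :
    ((quasicliquesThrough (graphOf (W.sym2.piecewise ω₀ ω)) α t T W).card : ℝ) =
      ∑ S ∈ powersetCard r univ, qcInd W ω₀ α t T S ω := by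
  classical
  unfold qcInd
  rw [sum_boole]
  congr 1
  symm
  refine card_bij (fun S _ => extend W S) (fun S hS => ?_) (fun S _ S' _ h => ?_) fun S hS => ?_
  · obtain ⟨h1, h2⟩ := mem_filter.1 hS
    have hc : #(extend W S) = t := by rw [card_extend, (mem_powersetCard.1 h1).2, hr]
    exact mem_quasicliquesThrough.2 ⟨⟨hc, (isQuasiclique_induce_iff hc).2 h2⟩, subset_extend W S⟩
  · ext ⟨v, hv⟩
    have h' : v ∈ extend W S ↔ v ∈ extend W S' := by
      rw [show extend W S = extend W S' from h]
    simpa [mem_extend, hv] using h'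
  · obtain ⟨⟨hc, hq⟩, hWS⟩ := mem_quasicliquesThrough.1 hS
    have he : extend W (S.subtype fun v => v ∉ W) = S := by
      ext v
      rw [mem_extend]
      by_cases hv : v ∈ W
      · simp [hv, hWS hv]
      · simp [hv]
    refine ⟨S.subtype fun v => v ∉ W, mem_filter.2 ⟨mem_powersetCard.2 ⟨subset_univ _, ?_⟩, ?_⟩, he⟩
    · have := card_extend W (S.subtype fun v => v ∉ W)
      rw [he, hc] at this
      omega
    · rw [he]
      exact (isQuasiclique_induce_iff hc).1 hq

theorem graphOf_eq_iff (ω : Sym2 V → Bool) (G : SimpleGraph V) [DecidableRel G.Adj] :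
    graphOf ω = G ↔ trace (pairs univ) ω = G.edgeFinset := by
  have h : ∀ u v, s(u, v) ∈ trace (pairs univ) ω ↔ (graphOf ω).Adj u v := by
    intro u v
    simp [mem_trace_pairs]
  constructor
  · rintro rfl
    ext e
    induction e with
    | _ u v => rw [h, SimpleGraph.mem_edgeFinset, SimpleGraph.mem_edgeSet]
  · intro he
    ext u v
    rw [← h, he, SimpleGraph.mem_edgeFinset, SimpleGraph.mem_edgeSet]

omit [DecidableEq V] in
theorem binomialRandom_half_singleton (G : SimpleGraph V) :
    (SimpleGraph.binomialRandom V half).real {G} = 1 / 2 ^ (Fintype.card V).choose 2 := by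
  classical
  have hle : G.edgeSet.ncard ≤ (Fintype.card V).choose 2 := by
    rw [← SimpleGraph.coe_edgeFinset, Set.ncard_coe_finset]
    exact SimpleGraph.card_edgeFinset_le_card_choose_two
  have h1 : ((unitInterval.toNNReal half : NNReal) : ℝ) = 1 / 2 := rfl
  have h2 : ((unitInterval.toNNReal (unitInterval.symm half) : NNReal) : ℝ) = 1 / 2 := by
    change (1 : ℝ) - 1 / 2 = 1 / 2
    norm_num
  rw [measureReal_def, SimpleGraph.binomialRandom_singleton, ENNReal.toReal_mul,
    ENNReal.toReal_pow, ENNReal.toReal_pow, ENNReal.coe_toReal, ENNReal.coe_toReal, h1, h2,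
    ← pow_add, Nat.card_eq_fintype_card, Nat.add_sub_cancel' hle, one_div_pow]

open Classical in
/-- The random graph is the graph of uniform random bits. -/
theorem binomialRandom_half_real (𝒢 : Set (SimpleGraph V)) :
    (SimpleGraph.binomialRandom V half).real 𝒢 =
      𝔼 ω : Sym2 V → Bool, if graphOf ω ∈ 𝒢 then (1 : ℝ) else 0 := by
  have h1 : ∀ ω : Sym2 V → Bool, (if graphOf ω ∈ 𝒢 then (1 : ℝ) else 0) =
      ∑ G ∈ 𝒢.toFinset, if trace (pairs univ) ω = G.edgeFinset then (1 : ℝ) else 0 := by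
    intro ω
    have : ∀ G ∈ 𝒢.toFinset, (if trace (pairs univ) ω = G.edgeFinset then (1 : ℝ) else 0) =
        if graphOf ω = G then (1 : ℝ) else 0 := by
      intro G _
      simp only [graphOf_eq_iff]
    rw [sum_congr rfl this, sum_ite_eq]
    simp
  have : MeasurableSingletonClass (SimpleGraph V) := ⟨fun G => by
    have h2 := SimpleGraph.measurableEmbedding_edgeSet (V := V)
      |>.measurable (measurableSet_singleton G.edgeSet)
    convert h2
    ext H
    simp⟩
  rw [expect_congr rfl fun ω _ => h1 ω, expect_sum_comm]
  conv_lhs => rw [← Set.coe_toFinset 𝒢, ← sum_measureReal_singleton]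
  refine sum_congr rfl fun G _ => ?_
  rw [binomialRandom_half_singleton, expect_trace_eq, card_pairs, card_univ]
  intro e he
  induction e with
  | _ u v =>
    rw [mk_mem_pairs]
    exact ⟨⟨mem_univ _, mem_univ _⟩, (SimpleGraph.mem_edgeFinset.1 he).ne⟩

omit [DecidableEq V] in
theorem quasicliquesThrough_empty (G : SimpleGraph V) (α : ℝ) (t T : ℕ) :
    quasicliquesThrough G α t T ∅ = quasicliques G α t T := by
  classical
  simp [quasicliquesThrough]

end Graphs

/-! ### The counting lemma -/

section Counting

variable {V : Type*} [DecidableEq V] [Fintype V]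

open Classical in
/-- Concentration of the number of quasicliques through `W`, for the parameters of the counting
lemma. -/
theorem expect_not_plusMinus_le_exp {n t T : ℕ} {L α : ℝ} (hV : Fintype.card V = n)
    (hn : (n : ℝ) = Real.exp L) (hL : 1000 ≤ L) (hG : 64 * L ^ 10 ≤ Real.exp (0.0007 * L))
    (hα0 : 0 < α) (hα1 : α ≤ 1 / 2) (hαL : 1 / L ≤ α ^ 2)
    (ht : |(t : ℝ) - c * α ^ (-2 : ℤ) * L| < 1)
    (hT : |(T : ℝ) - (1 / 2 + α) * (t.choose 2 : ℝ)| < 1) {W : Finset V} (hW : #W = 0 ∨ #W = 2)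
    {ω₀ : Sym2 V → Bool} {a : ℕ} (ha : #(trace (pairs W) ω₀) = a) {M : ℝ}
    (hM : 2 ≤ t → 1 ≤ T → M = ((n - #W).choose (t - #W) : ℝ) *
      exactProb (t.choose 2) ((#W).choose 2) T a) :
    𝔼 ω, (if PlusMinus
        ((quasicliquesThrough (graphOf (W.sym2.piecewise ω₀ ω)) α t T W).card : ℝ) M
        ((n : ℝ) ^ (-(A * α ^ 2)) * M) then (0 : ℝ) else 1) ≤
      2 * Real.exp (-Real.exp (0.22 * L)) := by
  classical
  obtain ⟨s1, s2, s3, s4⟩ := size_bounds hL hα0 hα1 hαL ht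
  obtain ⟨hA0, hA1⟩ := A_bounds
  have ht32 : (32 : ℝ) ≤ t := by
    have : α * t ≤ 1 / 2 * t := by gcongr
    linarith
  have ht2 : 2 ≤ t := by
    have : (2 : ℝ) ≤ t := by linarith
    exact_mod_cast this
  obtain ⟨T1, T2⟩ := abs_lt.1 hT
  have hN0 : (0 : ℝ) ≤ (t.choose 2 : ℝ) := Nat.cast_nonneg _
  have hTN : T ≤ t.choose 2 := by
    have h1 : (1 / 2 + α) * (t.choose 2 : ℝ) ≤ 1 * (t.choose 2 : ℝ) := by gcongr; linarith
    have h2 : (T : ℝ) < (t.choose 2 : ℝ) + 1 := by linarith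
    have : T < t.choose 2 + 1 := by exact_mod_cast h2
    omega
  have hT1 : 1 ≤ T := by
    have hNr : (t.choose 2 : ℝ) = t * (t - 1) / 2 := Nat.cast_choose_two ℝ t
    have h1 : 1 / 2 * (t.choose 2 : ℝ) ≤ (1 / 2 + α) * (t.choose 2 : ℝ) := by gcongr; linarith
    have h2 : (0 : ℝ) < T := by
      have : (4 : ℝ) ≤ (t.choose 2 : ℝ) := by rw [hNr]; nlinarith
      linarith
    exact_mod_cast h2
  have hM := hM ht2 hT1
  have hW1 : (#W).choose 2 ≤ 1 := by rcases hW with h | h <;> rw [h] <;> decide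
  have hW2 : #W ≤ 2 := by rcases hW with h | h <;> omega
  have hac : a ≤ (#W).choose 2 := by
    rw [← ha, ← card_pairs]
    exact card_le_card (filter_subset _ _)
  have haT : a ≤ T := by omega
  have hα2 : α ^ 2 ≤ 1 / 4 := by nlinarith
  set δ : ℝ := (n : ℝ) ^ (-(A * α ^ 2)) with hδ
  have hδe : δ = Real.exp (-(A * α ^ 2 * L)) := by
    rw [hδ, hn, ← Real.exp_mul]
    congr 1
    ring
  have hAα0 : 0 ≤ A * α ^ 2 := by positivity
  have hAα : A * α ^ 2 ≤ 0.0001 := by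
    calc A * α ^ 2 ≤ 0.000002 * (1 / 4) := by gcongr
      _ ≤ _ := by norm_num
  have hδ1 : δ ≤ 1 := by
    rw [hδe]
    exact Real.exp_le_one_iff.2 (by nlinarith)
  have hδl : Real.exp (-(0.0001 * L)) ≤ δ := by
    rw [hδe]
    exact Real.exp_le_exp.2 (neg_le_neg (mul_le_mul_of_nonneg_right hAα (by linarith)))
  have hδ0 : 0 < δ := (Real.exp_pos _).trans_le hδl
  have hWn : #W ≤ n := by rw [← hV]; exact card_le_univ W
  have hn' : Fintype.card {v // v ∉ W} = n - #W := by
    rw [Fintype.card_subtype_compl, hV]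
    simp
  have hr : ((t - #W : ℕ) : ℝ) ≤ L ^ 2 := by
    refine le_trans ?_ s3
    exact_mod_cast Nat.sub_le t #W
  obtain ⟨b1, b2, b3, b4, b5, b6, b7, b8, b9⟩ := block_bounds (w := #W) hn hL hG hW2
    (Nat.sub_add_cancel hWn) rfl rfl hr hδl hδ1
  have hmain := expect_not_plusMinus_le (W := W) (ω₀ := ω₀) (r := t - #W) (M := M)
    (x := Real.exp (0.3 * L)) (j₀ := ⌈L / 10⌉₊) (δ := δ) (k := ⌊Real.exp (L / 4)⌋₊)
    hW hα0 hα1 ht2 s4 hT hTN (by rw [ha]; exact haT) (by omega) rfl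
    (Real.exp_pos _).le (fun j hj => small_overlap_bound (Nat.lt_ceil.1 hj).le)
    (fun hp j hj => large_overlap_bound hL hG hα0 hα1 s2 s3 s4 ht2 hT hTN hW
      (by rw [ha]; exact hac) (by rw [ha]; exact haT) hp (Nat.ceil_le.1 hj))
    hδ0 hδ1 (degree_loss_bound hL hG s1 s3 ht2 hδl) hn' b1 b2 b3 b4 b5 b6 b7
    (by rw [ha]; exact hM)
  calc _ ≤ Real.exp (-(⌊Real.exp (L / 4)⌋₊ * δ / 4)) +
        Real.exp (-(⌊Real.exp (L / 4)⌋₊ * δ ^ 2 / 8)) := by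
        refine le_trans (le_of_eq (expect_congr rfl fun ω _ => ?_)) hmain
        rw [card_quasicliquesThrough (r := t - #W) (by omega), PlusMinus]
        by_cases h : M - δ * M ≤ ∑ S ∈ powersetCard (t - #W) univ, qcInd W ω₀ α t T S ω ∧
            ∑ S ∈ powersetCard (t - #W) univ, qcInd W ω₀ α t T S ω ≤ M + δ * M
        · rw [if_pos h, if_neg (by rw [not_or, not_lt, not_lt]; exact h)]
        · rw [if_neg h, if_pos (by rwa [not_and_or, not_le, not_le] at h)]
    _ ≤ Real.exp (-Real.exp (0.22 * L)) + Real.exp (-Real.exp (0.22 * L)) := by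
        gcongr
    _ = _ := by ring

/-- The union bound over all pairs of vertices. -/
theorem le_binomialRandom_isGood {n t T : ℕ} {L α : ℝ} (hV : Fintype.card V = n)
    (hn : (n : ℝ) = Real.exp L) (hL : 1000 ≤ L) (hG : 64 * L ^ 10 ≤ Real.exp (0.0007 * L))
    (hα0 : 0 < α) (hα1 : α ≤ 1 / 2) (hαL : 1 / L ≤ α ^ 2)
    (ht : |(t : ℝ) - c * α ^ (-2 : ℤ) * L| < 1)
    (hT : |(T : ℝ) - (1 / 2 + α) * (t.choose 2 : ℝ)| < 1) :
    1 - (2 * (n : ℝ) ^ 2 + 1) * (2 * Real.exp (-Real.exp (0.22 * L))) ≤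
      (SimpleGraph.binomialRandom V half).real {G | IsGood α t T G} := by
  classical
  set N : ℕ := t.choose 2 with hN
  set δ : ℝ := (n : ℝ) ^ (-(A * α ^ 2)) with hδ
  set M : Bool → ℝ := fun b => ((n - 2).choose (t - 2) : ℝ) *
    ((N - 1).choose (if b then T - 1 else T) : ℝ) * 2 ^ (1 - (N : ℤ)) with hM
  set M₀ : ℝ := (n.choose t : ℝ) * (N.choose T : ℝ) * 2 ^ (-(N : ℤ)) with hM₀
  set bad : Finset V → Bool → ℝ → (Sym2 V → Bool) → ℝ := fun W b m ω => if PlusMinus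
    ((quasicliquesThrough (graphOf (W.sym2.piecewise (fun _ => b) ω)) α t T W).card : ℝ) m
    (δ * m) then (0 : ℝ) else 1 with hbad
  have hbad0 : ∀ W b m ω, 0 ≤ bad W b m ω := by
    intro W b m ω
    simp only [hbad]
    split_ifs <;> norm_num
  have hbadE : ∀ u v : V, u ≠ v → ∀ b, 𝔼 ω, bad {u, v} b (M b) ω ≤
      2 * Real.exp (-Real.exp (0.22 * L)) := by
    intro u v huv b
    have hc : #({u, v} : Finset V) = 2 := card_pair huv
    have hp : #(pairs ({u, v} : Finset V)) = 1 := by rw [card_pairs, hc]; rfl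
    refine expect_not_plusMinus_le_exp (a := if b then 1 else 0) hV hn hL hG hα0 hα1 hαL ht hT
      (Or.inr hc) ?_ fun ht2 _ => ?_
    · rw [trace]
      cases b
      · simp
      · simp [hp]
    · have hN1 : 1 ≤ N := Nat.choose_pos ht2
      have e : (2 : ℝ) ^ (1 - (N : ℤ)) = 1 / 2 ^ (N - 1) := by
        rw [show (1 - (N : ℤ)) = -((N - 1 : ℕ) : ℤ) by omega, zpow_neg, zpow_natCast, one_div]
      have hc2 : Nat.choose 2 2 = 1 := rfl
      simp only [hM, e, hc, hc2, exactProb]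
      cases b <;> simp [hN, div_eq_mul_inv, mul_assoc]
  have hbadE₀ : 𝔼 ω, bad ∅ false M₀ ω ≤ 2 * Real.exp (-Real.exp (0.22 * L)) := by
    refine expect_not_plusMinus_le_exp (a := 0) hV hn hL hG hα0 hα1 hαL ht hT
      (Or.inl card_empty) (by simp [trace]) fun _ _ => ?_
    simp [hM₀, exactProb, hN, div_eq_mul_inv, mul_assoc]
  set D : Finset (V × V) := univ.filter fun q => q.1 ≠ q.2 with hD
  have hpt : ∀ ω, 1 - (bad ∅ false M₀ ω + ∑ q ∈ D, ∑ b, bad {q.1, q.2} b (M b) ω) ≤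
      if graphOf ω ∈ {G : SimpleGraph V | IsGood α t T G} then (1 : ℝ) else 0 := by
    intro ω
    have hs : ∀ q ∈ D, 0 ≤ ∑ b, bad {q.1, q.2} b (M b) ω := fun q _ =>
      sum_nonneg fun b _ => hbad0 _ _ _ _
    have hs0 := sum_nonneg hs
    split_ifs with h
    · linarith [hbad0 ∅ false M₀ ω]
    · have hone : 1 ≤ bad ∅ false M₀ ω + ∑ q ∈ D, ∑ b, bad {q.1, q.2} b (M b) ω := by
        by_contra hlt
        refine h ?_
        have h0 : bad ∅ false M₀ ω < 1 := by linarith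
        have hq : ∀ u v : V, u ≠ v → ∀ b, bad {u, v} b (M b) ω < 1 := by
          intro u v huv b
          have h1 := single_le_sum hs (show (u, v) ∈ D from mem_filter.2 ⟨mem_univ _, huv⟩)
          have h2 := single_le_sum (f := fun b => bad {u, v} b (M b) ω)
            (fun b _ => hbad0 _ _ _ _) (mem_univ b)
          linarith [hbad0 ∅ false M₀ ω]
        have hgood : ∀ W b m, bad W b m ω < 1 → PlusMinus ((quasicliquesThrough
            (graphOf (W.sym2.piecewise (fun _ => b) ω)) α t T W).card : ℝ) m (δ * m) := by
          intro W b m hlt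
          by_contra hn
          simp only [hbad, if_neg hn] at hlt
          exact lt_irrefl _ hlt
        have hpair : ∀ u v : V, u ≠ v → ∀ b, ω s(u, v) = b → PlusMinus
            ((quasicliquesThrough (graphOf ω) α t T {u, v}).card : ℝ) (M b) (δ * M b) := by
          intro u v huv b hb
          have := hgood _ _ _ (hq u v huv b)
          rwa [graphOf_piecewise_const hb] at this
        simp only [Set.mem_ofPred_eq, IsGood, hV]
        refine ⟨fun u v huv => ?_, fun u v huv hadj => ?_, ?_⟩
        · obtain ⟨h1, h2⟩ := graphOf_adj.1 huv
          convert hpair u v h2 true h1 <;> rfl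
        · have hb : ω s(u, v) = false := by
            rw [graphOf_adj] at hadj
            simpa [huv] using hadj
          convert hpair u v huv false hb <;> rfl
        · have := hgood _ _ _ h0
          rwa [sym2_empty, piecewise_empty, quasicliquesThrough_empty] at this
      linarith
  rw [binomialRandom_half_real]
  refine le_trans ?_ (expect_le_expect fun ω _ => hpt ω)
  rw [expect_sub_distrib, Fintype.expect_const, expect_add_distrib, expect_sum_comm]
  have hsum : ∑ q ∈ D, 𝔼 ω, ∑ b, bad {q.1, q.2} b (M b) ω ≤
      (n : ℝ) ^ 2 * (2 * (2 * Real.exp (-Real.exp (0.22 * L)))) := by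
    calc _ ≤ ∑ _q ∈ D, 2 * (2 * Real.exp (-Real.exp (0.22 * L))) := by
          refine sum_le_sum fun q hq => ?_
          rw [expect_sum_comm, Fintype.sum_bool, two_mul]
          have hne : q.1 ≠ q.2 := (mem_filter.1 hq).2
          exact add_le_add (hbadE _ _ hne true) (hbadE _ _ hne false)
      _ ≤ _ := by
          rw [sum_const, nsmul_eq_mul]
          refine mul_le_mul_of_nonneg_right ?_ (by positivity)
          have : #D ≤ n ^ 2 := by
            refine (card_le_univ D).trans (le_of_eq ?_)
            rw [Fintype.card_prod, hV, pow_two]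
          exact_mod_cast this
  linarith

end Counting

end QuasicliqueCounting

theorem mainTheorem2 :
    ∀ ε : ℝ, 0 < ε → ∃ n₁ : ℕ, ∀ (n t T : ℕ) (α : ℝ),
      n₁ ≤ n → 0 < t → 0 < α →
      (1 / Real.log n) ^ (1 / 2 - ε) ≤ α → α ≤ 1 / 2 →
      QuasicliqueCounting.IsRounding (QuasicliqueCounting.c * α ^ (-2 : ℤ) * Real.log n) t →
      QuasicliqueCounting.IsRounding ((1 / 2 + α) * (t.choose 2 : ℝ)) T →
      1 - 2 * Real.exp (-((n : ℝ) ^ (1 / 5 : ℝ))) ≤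
        (SimpleGraph.binomialRandom (Fin n) QuasicliqueCounting.half).real
          {G : SimpleGraph (Fin n) | QuasicliqueCounting.IsGood α t T G} := by
  intro ε hε
  have hlog : Filter.Tendsto (fun n : ℕ => Real.log n) Filter.atTop Filter.atTop :=
    Real.tendsto_log_atTop.comp tendsto_natCast_atTop_atTop
  obtain ⟨n₁, hn₁⟩ := Filter.eventually_atTop.1
    ((hlog.eventually QuasicliqueCounting.eventually_pow_le_exp).and
      (hlog.eventually_ge_atTop 1000))
  refine ⟨max n₁ 1, fun n t T α hn _ hα0 hα hα1 ht hT => ?_⟩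
  obtain ⟨hG, hL⟩ := hn₁ n ((le_max_left _ _).trans hn)
  have hn0 : (0 : ℝ) < n := by exact_mod_cast (le_max_right n₁ 1).trans hn
  have hexp : (n : ℝ) = Real.exp (Real.log n) := (Real.exp_log hn0).symm
  have hL0 : 0 < Real.log n := by linarith
  have hαL : 1 / Real.log n ≤ α ^ 2 := by
    have h1 : (1 / Real.log n) ^ (1 / 2 : ℝ) ≤ (1 / Real.log n) ^ (1 / 2 - ε) := by
      refine Real.rpow_le_rpow_of_exponent_ge (by positivity) ?_ (by linarith)
      exact (div_le_one hL0).2 (by linarith)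
    have h2 : (1 / Real.log n) ^ (1 / 2 : ℝ) ≤ α := h1.trans hα
    calc 1 / Real.log n = ((1 / Real.log n) ^ (1 / 2 : ℝ)) ^ 2 := by
          rw [← Real.rpow_natCast, ← Real.rpow_mul (by positivity)]
          norm_num
      _ ≤ α ^ 2 := by gcongr
  have h := QuasicliqueCounting.le_binomialRandom_isGood (V := Fin n) (Fintype.card_fin n) hexp hL
    hG hα0 hα1 hαL ht hT
  have h' := QuasicliqueCounting.union_bound_numeric hexp hL hG
  linarith
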